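/- Fix a free ultrafilter $\omega$ on $\mathbb N$. For a C*-algebra $A$ write $A_\omega=\ell^\infty(A)/\{(a_n):\lim_{n\to\omega}\|a_n\|=0\}$ for its ultrapower, with $A$ mapped into $A_\omega$ as constant sequences. **Traces.** $T_b(A)$ is the cone of bounded positive linear functionals $\tau$ on $A$ with $\tau(ab)=\tau(ba)$, and $T(A)\subseteq T_b(A)$ is the set of those of norm $1$ (tracial states), with the weak-* topology. An (extended) trace on $A$ is a map $\tau:A_+\to[0,\infty]$ with $\tau(0)=0$, $\tau(\lambda_1a_1+\lambda_2a_2)=\lambda_1\tau(a_1)+\lambda_2\tau(a_2)$ for $\lambda_i>0$, $a_i\in A_+$, and $\tau(a^*a)=\tau(aa^*)$ for $a\in A$; it is densely defined if $\mathrm{span}\{a\in A_+:\tau(a)<\infty\}$ is dense in $A$. $T^+(A)$ is the cone of densely defined, lower semicontinuous traces. Restricting to $A_+$, one regards $T_b(A)$ as a set of extended traces. **Uniform property $\Gamma$.** A limit trace is a tracial state $\tau$ on $A_\omega$ for which there are $\tau_n\in T(A)$ with $\tau((a_n))=\lim_{n\to\omega}\tau_n(a_n)$ for all $(a_n)$;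 $T_\omega(A)$ is the set of limit traces. Let $A^\omega=A_\omega/J_A$ with $J_A=\{x\in A_\omega:\tau(x^*x)=0\ \text{for all}\ \tau\in T_\omega(A)\}$; limit traces descend to $A^\omega$. A separable C*-algebra $A$ with $T(A)$ non-empty and compact has uniform property $\Gamma$ if for every $n\ge1$ there are projections $p_1,\dots,p_n\in A^\omega$, commuting with the image of $A$ and summing to the unit of $A^\omega$, such that $\tau(ap_i)=\frac1n\tau(a)$ for all $a\in A$, $\tau\in T_\omega(A)$ and $i=1,\dots,n$. **Stabilised property $\Gamma$.** Let $F_\omega(A)=(A_\omega\cap A')/\mathrm{Ann}(A)$ with $\mathrm{Ann}(A)=\{x\in A_\omega: xa=ax=0\ \text{for all}\ a\in A\}$. A generalised limit trace is an extended trace $\tau$ on $A_\omega$ for which there is a sequence $(\tau_n)$ of lower semicontinuous traces on $A$ with $\tau((a_n))=\sup_{\varepsilon>0}\lim_{n\to\omega}\tau_n((a_n-\varepsilon)_+)$ for all bounded sequences $(a_n)$ in $A_+$; $\widetilde T_\omega(A)$ is the set of these. For $\tau\in\widetilde T_\omega(A)$ and $a\in A_+$, let $\tau_a:F_\omega(A)_+\to[0,\infty]$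 be the map induced by $x\mapsto\tau(ax)$. A separable C*-algebra $A$ has stabilised property $\Gamma$ if for every $n\ge1$ there are pairwise orthogonal positive contractions $e_1,\dots,e_n\in F_\omega(A)$ such that $\tau_a(e_i)=\frac1n\tau(a)$ for $i=1,\dots,n$ and all $a\in A_+$, $\tau\in\widetilde T_\omega(A)$ with $\tau(a)<\infty$. **Proposition.** Let $A$ be a simple separable C*-algebra (not necessarily unital) with $T(A)$ compact and non-empty. (i) If $A$ has stabilised property $\Gamma$, then $A$ has uniform property $\Gamma$. (ii) If $A$ is unital, or more generally if $T^+(A)=T_b(A)$, and $A$ has uniform property $\Gamma$, then $A$ has stabilised property $\Gamma$. -/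

import Mathlib

noncomputable section

namespace CStarGamma

open Filter Topology
open scoped ENNReal

/-! ### Quotients of C*-algebras by closed ideals -/

/-- A closed two-sided ideal of a C*-algebra. (Closed two-sided ideals are automatically closed
under scalar multiplication and under the involution.) -/
structure ClosedIdeal (A : Type*) [NonUnitalCStarAlgebra A] extends Submodule ℂ A where
  mul_left_mem' : ∀ (a : A) {x : A}, x ∈ carrier → a * x ∈ carrier
  mul_right_mem' : ∀ (a : A) {x : A}, x ∈ carrier → x * a ∈ carrier
  star_mem' : ∀ {x : A}, x ∈ carrier → star x ∈ carrier
  isClosed' : IsClosed carrier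

namespace ClosedIdeal

variable {A : Type*} [NonUnitalCStarAlgebra A] (I : ClosedIdeal A)

/-- The quotient of a C*-algebra by a closed two-sided ideal, with the quotient norm. -/
def Quotient : Type _ := A ⧸ I.toSubmodule

instance : NormedAddCommGroup I.Quotient :=
  haveI : IsClosed (I.toSubmodule : Set A) := I.isClosed'
  inferInstanceAs (NormedAddCommGroup (A ⧸ I.toSubmodule))

instance : NormedSpace ℂ I.Quotient :=
  inferInstanceAs (NormedSpace ℂ (A ⧸ I.toSubmodule))

instance : CompleteSpace I.Quotient :=
  inferInstanceAs (CompleteSpace (A ⧸ I.toSubmodule))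

/-- The quotient map. -/
def proj : A →ₗ[ℂ] I.Quotient := I.toSubmodule.mkQ

lemma proj_surjective : Function.Surjective I.proj := I.toSubmodule.mkQ_surjective

lemma proj_eq_proj {a b : A} : I.proj a = I.proj b ↔ a - b ∈ I.toSubmodule :=
  Submodule.Quotient.eq I.toSubmodule

lemma norm_proj_le (a : A) : ‖I.proj a‖ ≤ ‖a‖ := Submodule.Quotient.norm_mk_le (S := I.toSubmodule) a

lemma exists_lift_norm_lt (q : I.Quotient) {ε : ℝ} (hε : 0 < ε) :
    ∃ a : A, I.proj a = q ∧ ‖a‖ < ‖q‖ + ε :=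
  Submodule.Quotient.norm_mk_lt (S := I.toSubmodule) q hε

instance : Mul I.Quotient where
  mul := Quotient.map₂ (· * ·) (by
    intro a a' ha b b' hb
    rw [← Quotient.eq_iff_equiv] at ha hb ⊢
    have ha' : a - a' ∈ I.toSubmodule := (Submodule.Quotient.eq I.toSubmodule).1 ha
    have hb' : b - b' ∈ I.toSubmodule := (Submodule.Quotient.eq I.toSubmodule).1 hb
    refine (Submodule.Quotient.eq I.toSubmodule).2 ?_
    have : a * b - a' * b' = (a - a') * b + a' * (b - b') := by noncomm_ring
    rw [this]
    exact add_mem (I.mul_right_mem' b ha') (I.mul_left_mem' a' hb'))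

lemma proj_mul (a b : A) : I.proj (a * b) = I.proj a * I.proj b := rfl

instance : Star I.Quotient where
  star := Quotient.map star (by
    intro a a' ha
    rw [← Quotient.eq_iff_equiv] at ha ⊢
    have ha' : a - a' ∈ I.toSubmodule := (Submodule.Quotient.eq I.toSubmodule).1 ha
    refine (Submodule.Quotient.eq I.toSubmodule).2 ?_
    rw [← star_sub]
    exact I.star_mem' ha')

lemma proj_star (a : A) : I.proj (star a) = star (I.proj a) := rfl

instance : NonUnitalRing I.Quotient :=
  { (inferInstance : AddCommGroup I.Quotient), (inferInstance : Mul I.Quotient) with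
    left_distrib := by
      intro x y z
      obtain ⟨a, rfl⟩ := I.proj_surjective x
      obtain ⟨b, rfl⟩ := I.proj_surjective y
      obtain ⟨c, rfl⟩ := I.proj_surjective z
      simp only [← map_add, ← proj_mul, mul_add]
    right_distrib := by
      intro x y z
      obtain ⟨a, rfl⟩ := I.proj_surjective x
      obtain ⟨b, rfl⟩ := I.proj_surjective y
      obtain ⟨c, rfl⟩ := I.proj_surjective z
      simp only [← map_add, ← proj_mul, add_mul]
    zero_mul := by
      intro x
      obtain ⟨a, rfl⟩ := I.proj_surjective x
      rw [← map_zero I.proj, ← proj_mul, zero_mul]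
    mul_zero := by
      intro x
      obtain ⟨a, rfl⟩ := I.proj_surjective x
      rw [← map_zero I.proj, ← proj_mul, mul_zero]
    mul_assoc := by
      intro x y z
      obtain ⟨a, rfl⟩ := I.proj_surjective x
      obtain ⟨b, rfl⟩ := I.proj_surjective y
      obtain ⟨c, rfl⟩ := I.proj_surjective z
      simp only [← proj_mul, mul_assoc] }

instance : NonUnitalNormedRing I.Quotient :=
  { (inferInstance : NormedAddCommGroup I.Quotient),
    (inferInstance : NonUnitalRing I.Quotient) with
    norm_mul_le := by
      intro x y
      refine le_of_forall_pos_le_add fun δ hδ => ?_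
      have hc : Tendsto (fun ε : ℝ => (‖x‖ + ε) * (‖y‖ + ε)) (𝓝[>] 0) (𝓝 (‖x‖ * ‖y‖)) := by
        have : Continuous fun ε : ℝ => (‖x‖ + ε) * (‖y‖ + ε) := by fun_prop
        simpa using (this.tendsto 0).mono_left nhdsWithin_le_nhds
      have h1 := (hc.eventually (gt_mem_nhds (lt_add_of_pos_right _ hδ))).and
        self_mem_nhdsWithin
      obtain ⟨ε, hε, hε0⟩ := h1.exists
      obtain ⟨a, rfl, ha⟩ := I.exists_lift_norm_lt x hε0
      obtain ⟨b, rfl, hb⟩ := I.exists_lift_norm_lt y hε0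
      calc ‖I.proj a * I.proj b‖ = ‖I.proj (a * b)‖ := rfl
        _ ≤ ‖a * b‖ := I.norm_proj_le _
        _ ≤ ‖a‖ * ‖b‖ := norm_mul_le _ _
        _ ≤ (‖I.proj a‖ + ε) * (‖I.proj b‖ + ε) := by gcongr
        _ ≤ _ := hε.le }

instance : StarRing I.Quotient where
  star_involutive := by
    intro x
    obtain ⟨a, rfl⟩ := I.proj_surjective x
    rw [← proj_star, ← proj_star, star_star]
  star_mul := by
    intro x y
    obtain ⟨a, rfl⟩ := I.proj_surjective x
    obtain ⟨b, rfl⟩ := I.proj_surjective y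
    simp only [← proj_mul, ← proj_star, star_mul]
  star_add := by
    intro x y
    obtain ⟨a, rfl⟩ := I.proj_surjective x
    obtain ⟨b, rfl⟩ := I.proj_surjective y
    simp only [← map_add, ← proj_star, star_add]

instance : IsScalarTower ℂ I.Quotient I.Quotient where
  smul_assoc := by
    intro c x y
    obtain ⟨a, rfl⟩ := I.proj_surjective x
    obtain ⟨b, rfl⟩ := I.proj_surjective y
    simp only [smul_eq_mul, ← map_smul, ← proj_mul, smul_mul_assoc]

instance : SMulCommClass ℂ I.Quotient I.Quotient where
  smul_comm := by
    intro c x y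
    obtain ⟨a, rfl⟩ := I.proj_surjective x
    obtain ⟨b, rfl⟩ := I.proj_surjective y
    simp only [smul_eq_mul, ← map_smul, ← proj_mul, mul_smul_comm]

instance : StarModule ℂ I.Quotient where
  star_smul := by
    intro c x
    obtain ⟨a, rfl⟩ := I.proj_surjective x
    simp only [← map_smul, ← proj_star, star_smul]

/-- A closed ideal, viewed as a C*-subalgebra. -/
def toSubalgebra : NonUnitalStarSubalgebra ℂ A :=
  { I.toSubmodule with
    mul_mem' := fun {a _} _ hb => I.mul_left_mem' a hb
    star_mem' := fun h => I.star_mem' h }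

/-- Elements of a closed ideal have approximate right units in the ideal. -/
lemma exists_approx_unit {x : A} (hx : x ∈ I.toSubmodule) {ε : ℝ} (hε : 0 < ε) :
    ∃ e ∈ I.toSubmodule, (∃ y : A, e = star y * y) ∧ ‖e‖ ≤ 1 ∧ ‖x - x * e‖ < ε := by
  have : IsClosed (I.toSubalgebra : Set A) := I.isClosed'
  let : NonUnitalCStarAlgebra I.toSubalgebra :=
    NonUnitalStarSubalgebra.nonUnitalCStarAlgebra I.toSubalgebra
  let := CStarAlgebra.spectralOrder I.toSubalgebra
  have := CStarAlgebra.spectralOrderedRing I.toSubalgebra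
  have h := CStarAlgebra.increasingApproximateUnit (A := I.toSubalgebra)
  let x' : I.toSubalgebra := ⟨x, hx⟩
  have ht := h.tendsto_mul_left x'
  have h1 : ∀ᶠ e in CStarAlgebra.approximateUnit I.toSubalgebra, dist (x' * e) x' < ε :=
    ht.eventually (Metric.ball_mem_nhds _ hε)
  have h2 := h.eventually_nonneg
  have h3 := h.eventually_norm
  obtain ⟨e, he1, he2, he3⟩ := (h1.and (h2.and h3)).exists
  obtain ⟨y, hy⟩ := CStarAlgebra.nonneg_iff_eq_star_mul_self.1 he2
  refine ⟨e, e.2, ⟨y, by rw [hy]; rfl⟩, he3, ?_⟩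
  rw [dist_comm, dist_eq_norm] at he1
  exact he1

lemma norm_sub_mul_sq_le (a x e y : A) (he : e = star y * y) (he1 : ‖e‖ ≤ 1) :
    ‖a - a * e‖ * ‖a - a * e‖ ≤ ‖star a * a + x‖ + ‖x - x * e‖ := by
  rw [← CStarRing.norm_star_mul_self]
  let f : Unitization ℂ A := 1 - (e : Unitization ℂ A)
  have hes : star e = e := by rw [he]; simp
  have he0 : (0 : Unitization ℂ A) ≤ (e : Unitization ℂ A) := by
    rw [he, Unitization.inr_mul, Unitization.inr_star]
    exact star_mul_self_nonneg _
  have he1' : (e : Unitization ℂ A) ≤ 1 :=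
    (CStarAlgebra.norm_le_one_iff_of_nonneg _ he0).1 (by rwa [Unitization.norm_inr])
  have hf0 : 0 ≤ f := sub_nonneg.2 he1'
  have hf1 : ‖f‖ ≤ 1 := (CStarAlgebra.norm_le_one_iff_of_nonneg _ hf0).2 (sub_le_self _ he0)
  have key : ((star (a - a * e) * (a - a * e) : A) : Unitization ℂ A) =
      f * ((star a * a + x : A) : Unitization ℂ A) * f - f * ((x - x * e : A)) := by
    simp only [f, star_sub, star_mul, hes, Unitization.inr_sub, Unitization.inr_mul,
      Unitization.inr_add]
    noncomm_ring
  rw [← Unitization.norm_inr (𝕜 := ℂ), key]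
  refine (norm_sub_le _ _).trans (add_le_add ?_ ?_)
  · rw [← Unitization.norm_inr (𝕜 := ℂ) (star a * a + x)]
    calc _ ≤ ‖f‖ * ‖((star a * a + x : A) : Unitization ℂ A)‖ * ‖f‖ :=
          (norm_mul_le _ _).trans (by gcongr; exact norm_mul_le _ _)
      _ ≤ 1 * ‖((star a * a + x : A) : Unitization ℂ A)‖ * 1 := by gcongr
      _ = _ := by ring
  · rw [← Unitization.norm_inr (𝕜 := ℂ) (x - x * e)]
    calc _ ≤ ‖f‖ * ‖((x - x * e : A) : Unitization ℂ A)‖ := norm_mul_le _ _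
      _ ≤ 1 * ‖((x - x * e : A) : Unitization ℂ A)‖ := by gcongr
      _ = _ := by ring

instance : CStarRing I.Quotient where
  norm_mul_self_le := by
    intro q
    obtain ⟨a, rfl⟩ := I.proj_surjective q
    refine le_of_forall_pos_le_add fun δ hδ => ?_
    obtain ⟨b, hb, hbn⟩ := I.exists_lift_norm_lt (star (I.proj a) * I.proj a) (half_pos hδ)
    rw [← proj_star, ← proj_mul, proj_eq_proj] at hb
    obtain ⟨e, heI, ⟨y, hy⟩, he1, hex⟩ := I.exists_approx_unit hb (half_pos hδ)
    have h1 : ‖I.proj a‖ ≤ ‖a - a * e‖ := by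
      have : I.proj a = I.proj (a - a * e) := by
        rw [proj_eq_proj]
        simpa using I.mul_left_mem' a heI
      rw [this]; exact I.norm_proj_le _
    have h2 := norm_sub_mul_sq_le a (b - star a * a) e y hy he1
    have h3 : star a * a + (b - star a * a) = b := by abel
    rw [h3] at h2
    calc ‖I.proj a‖ * ‖I.proj a‖ ≤ ‖a - a * e‖ * ‖a - a * e‖ := by gcongr
      _ ≤ _ := h2
      _ ≤ _ := by linarith

instance : NonUnitalCStarAlgebra I.Quotient where

/-- The C*-algebraic order on the quotient: the positive elements are the `star y * y`. -/
instance : PartialOrder I.Quotient := CStarAlgebra.spectralOrder I.Quotient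

instance : StarOrderedRing I.Quotient := CStarAlgebra.spectralOrderedRing I.Quotient

lemma proj_nonneg [PartialOrder A] [StarOrderedRing A] {a : A} (ha : 0 ≤ a) : 0 ≤ I.proj a := by
  obtain ⟨y, rfl⟩ := CStarAlgebra.nonneg_iff_eq_star_mul_self.1 ha
  rw [proj_mul, proj_star]
  exact star_mul_self_nonneg _

end ClosedIdeal

/-! ### Traces -/

section Traces

/-- `A` is simple: non-zero, and without non-trivial closed two-sided ideals. -/
def IsSimpleCStar (A : Type*) [NonUnitalCStarAlgebra A] : Prop :=
  Nontrivial A ∧ ∀ I : TwoSidedIdeal A, IsClosed (I : Set A) → I = ⊥ ∨ I = ⊤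

/-- `A` has a multiplicative unit. -/
def IsUnital (A : Type*) [NonUnitalCStarAlgebra A] : Prop :=
  ∃ u : A, ∀ a : A, u * a = a ∧ a * u = a

open scoped ComplexOrder in
/-- Bounded positive linear functionals with the trace identity. -/
def boundedTraces (A : Type*) [NonUnitalCStarAlgebra A] : Set (WeakDual ℂ A) :=
  {φ | (∀ a : A, 0 ≤ φ (star a * a)) ∧ ∀ a b : A, φ (a * b) = φ (b * a)}

/-- The tracial states `T(A)`, inside the dual of `A` with the weak-* topology. -/
def tracialStates (A : Type*) [NonUnitalCStarAlgebra A] : Set (WeakDual ℂ A) :=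
  {φ | φ ∈ boundedTraces A ∧ ‖WeakDual.toStrongDual φ‖ = 1}

variable (A : Type*) [NonUnitalCStarAlgebra A] [PartialOrder A] [StarOrderedRing A]

/-- The positive cone `A₊`, with the norm topology. -/
abbrev PosCone : Type _ := {a : A // 0 ≤ a}

/-- Extended traces `τ : A₊ → [0, ∞]`. -/
structure ExtTrace where
  toFun : PosCone A → ℝ≥0∞
  map_zero' : toFun ⟨0, le_rfl⟩ = 0
  map_comb' : ∀ (c d : NNReal), 0 < c → 0 < d → ∀ a b : PosCone A,
    toFun ⟨(c : ℝ) • a.1 + (d : ℝ) • b.1,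
      add_nonneg (smul_nonneg c.2 a.2) (smul_nonneg d.2 b.2)⟩ = c * toFun a + d * toFun b
  map_star_mul' : ∀ a : A,
    toFun ⟨star a * a, star_mul_self_nonneg a⟩ = toFun ⟨a * star a, mul_star_self_nonneg a⟩

variable {A}

instance : CoeFun (ExtTrace A) (fun _ => PosCone A → ℝ≥0∞) := ⟨ExtTrace.toFun⟩

/-- `Dom(τ) = span {a ∈ A₊ : τ(a) < ∞}`. -/
def ExtTrace.dom (τ : ExtTrace A) : Submodule ℂ A :=
  Submodule.span ℂ {a : A | ∃ h : 0 ≤ a, τ ⟨a, h⟩ < ∞}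

def ExtTrace.IsDenselyDefined (τ : ExtTrace A) : Prop := Dense (τ.dom : Set A)

def ExtTrace.IsLsc (τ : ExtTrace A) : Prop := LowerSemicontinuous τ.toFun

variable (A)

/-- `T⁺(A)`: the densely defined, lower semicontinuous traces. -/
def denselyDefinedLscTraces : Set (ExtTrace A) := {τ | τ.IsDenselyDefined ∧ τ.IsLsc}

/-- `T_b(A)` as a set of extended traces: the restrictions to `A₊` of the bounded traces. -/
def boundedExtTraces : Set (ExtTrace A) :=
  {τ | ∃ φ ∈ boundedTraces A, ∀ a : PosCone A, τ a = ENNReal.ofReal (φ a.1).re}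

variable {A}

/-- `(a - ε)₊`, for `a ≥ 0` and `ε > 0`. -/
def cutDown (a : A) (ε : ℝ) : PosCone A :=
  ⟨cfcₙ (fun t : ℝ => max (t - ε) 0) a, cfcₙ_nonneg fun _ _ => le_max_right _ _⟩

end Traces

/-! ### The ultrapower and Kirchberg's central sequence algebra -/

section Ultrapower

variable (ω : Ultrafilter ℕ) (A : Type*) [NonUnitalCStarAlgebra A]

/-- `ℓ^∞(A)`. -/
abbrev BddSeq : Type _ := lp (fun _ : ℕ => A) ∞

/-- `{(aₙ) : lim_{n → ω} ‖aₙ‖ = 0}`. -/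
def nullIdeal : ClosedIdeal (BddSeq A) where
  carrier := {a | Tendsto (fun n => ‖a n‖) ω (𝓝 0)}
  add_mem' := by
    intro a b ha hb
    refine squeeze_zero (fun n => norm_nonneg _) (fun n => norm_add_le (a n) (b n)) ?_
    simpa using Tendsto.add ha hb
  zero_mem' := by simp
  smul_mem' := by
    intro c a ha
    have : Tendsto (fun n => ‖c‖ * ‖a n‖) ω (𝓝 (‖c‖ * 0)) := Tendsto.const_mul _ ha
    simpa [norm_smul] using this
  mul_left_mem' := by
    intro a x hx
    have : Tendsto (fun n => ‖a‖ * ‖x n‖) ω (𝓝 (‖a‖ * 0)) := Tendsto.const_mul _ hx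
    rw [mul_zero] at this
    refine squeeze_zero (fun n => norm_nonneg _) (fun n => ?_) this
    refine (norm_mul_le (a n) (x n)).trans ?_
    gcongr
    exact lp.norm_apply_le_norm ENNReal.top_ne_zero a n
  mul_right_mem' := by
    intro a x hx
    have : Tendsto (fun n => ‖x n‖ * ‖a‖) ω (𝓝 (0 * ‖a‖)) := Tendsto.mul_const _ hx
    rw [zero_mul] at this
    refine squeeze_zero (fun n => norm_nonneg _) (fun n => ?_) this
    refine (norm_mul_le (x n) (a n)).trans ?_
    gcongr
    exact lp.norm_apply_le_norm ENNReal.top_ne_zero a n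
  star_mem' := by
    intro x hx
    simpa using! hx
  isClosed' := by
    refine isClosed_of_closure_subset fun a ha => ?_
    refine Metric.tendsto_nhds.2 fun ε hε => ?_
    obtain ⟨b, hb, hab⟩ := Metric.mem_closure_iff.1 ha (ε / 2) (half_pos hε)
    filter_upwards [Metric.tendsto_nhds.1 hb (ε / 2) (half_pos hε)] with n hn
    have h1 : ‖a n - b n‖ ≤ ‖a - b‖ := lp.norm_apply_le_norm ENNReal.top_ne_zero (a - b) n
    rw [dist_eq_norm] at hab
    simp only [dist_zero_right, norm_norm] at hn ⊢
    have h2 : ‖a n‖ ≤ ‖a n - b n‖ + ‖b n‖ := by simpa using norm_add_le (a n - b n) (b n)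
    linarith

/-- The ultrapower `A_ω`. -/
abbrev Ultrapower : Type _ := (nullIdeal ω A).Quotient

variable {A}

/-- The class in `A_ω` of a bounded sequence. -/
def ofSeq (a : BddSeq A) : Ultrapower ω A := (nullIdeal ω A).proj a

/-- Constant sequences. -/
def constSeq (a : A) : BddSeq A :=
  ⟨fun _ => a, memℓp_infty ⟨‖a‖, by rintro _ ⟨n, rfl⟩; exact le_rfl⟩⟩

/-- The canonical embedding of `A` in `A_ω`. -/
def diag (a : A) : Ultrapower ω A := ofSeq ω (constSeq a)

lemma star_diag (a : A) : star (diag ω a) = diag ω (star a) := by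
  rw [diag, diag, ofSeq, ofSeq, ← ClosedIdeal.proj_star]
  rfl

lemma ofSeq_nonneg [PartialOrder A] [StarOrderedRing A] (a : BddSeq A) (ha : ∀ n, 0 ≤ a n) :
    0 ≤ ofSeq ω a := by
  have h1 : ∀ n, star (CFC.sqrt (a n)) * CFC.sqrt (a n) = a n := fun n => by
    rw [(IsSelfAdjoint.of_nonneg (CFC.sqrt_nonneg (a n))).star_eq, CFC.sqrt_mul_sqrt_self _ (ha n)]
  let b : BddSeq A := ⟨fun n => CFC.sqrt (a n), memℓp_infty ⟨‖a‖ + 1, by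
    rintro _ ⟨n, rfl⟩
    have h2 : ‖CFC.sqrt (a n)‖ * ‖CFC.sqrt (a n)‖ = ‖a n‖ := by
      rw [← CStarRing.norm_star_mul_self, h1]
    have h3 : ‖a n‖ ≤ ‖a‖ := lp.norm_apply_le_norm ENNReal.top_ne_zero a n
    change ‖CFC.sqrt (a n)‖ ≤ ‖a‖ + 1
    nlinarith [norm_nonneg (CFC.sqrt (a n)), norm_nonneg a]⟩⟩
  have h4 : a = star b * b := by
    ext n
    exact (h1 n).symm
  rw [h4, ofSeq, ClosedIdeal.proj_mul, ClosedIdeal.proj_star]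
  exact star_mul_self_nonneg _

lemma diag_nonneg [PartialOrder A] [StarOrderedRing A] {a : A} (ha : 0 ≤ a) : 0 ≤ diag ω a :=
  ofSeq_nonneg ω _ fun _ => ha

variable (A)

/-- The relative commutant `A_ω ∩ A'`. -/
def relComm : NonUnitalStarSubalgebra ℂ (Ultrapower ω A) :=
  NonUnitalStarSubalgebra.centralizer ℂ (Set.range (diag ω : A → Ultrapower ω A))

variable {A} in
lemma mem_relComm {x : Ultrapower ω A} :
    x ∈ relComm ω A ↔ ∀ a : A, diag ω a * x = x * diag ω a := by
  rw [relComm, NonUnitalStarSubalgebra.mem_centralizer_iff]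
  constructor
  · intro h a
    exact (h _ ⟨a, rfl⟩).1
  · rintro h _ ⟨a, rfl⟩
    exact ⟨h a, by rw [star_diag]; exact h _⟩

instance : IsClosed (relComm ω A : Set (Ultrapower ω A)) := by
  have : (relComm ω A : Set (Ultrapower ω A)) =
      ⋂ a : A, {x | diag ω a * x = x * diag ω a} := by
    ext x
    simp only [Set.mem_iInter, Set.mem_ofPred_eq]
    exact mem_relComm ω
  rw [this]
  exact isClosed_iInter fun a => isClosed_eq (by fun_prop) (by fun_prop)

/-- The annihilator `Ann(A)` of `A` in `A_ω`, an ideal of `A_ω ∩ A'`. -/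
def annIdeal : ClosedIdeal (relComm ω A) where
  carrier := {x | ∀ a : A, x.1 * diag ω a = 0 ∧ diag ω a * x.1 = 0}
  add_mem' := by
    intro x y hx hy a
    constructor
    · simp [add_mul, (hx a).1, (hy a).1]
    · simp [mul_add, (hx a).2, (hy a).2]
  zero_mem' := by simp
  smul_mem' := by
    intro c x hx a
    constructor
    · simp [smul_mul_assoc, (hx a).1]
    · simp [mul_smul_comm, (hx a).2]
  mul_left_mem' := by
    intro y x hx a
    constructor
    · simp [mul_assoc, (hx a).1]
    · change diag ω a * (y.1 * x.1) = 0
      rw [← mul_assoc, (mem_relComm ω).1 y.2 a, mul_assoc, (hx a).2, mul_zero]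
  mul_right_mem' := by
    intro y x hx a
    constructor
    · change x.1 * y.1 * diag ω a = 0
      rw [mul_assoc, ← (mem_relComm ω).1 y.2 a, ← mul_assoc, (hx a).1, zero_mul]
    · change diag ω a * (x.1 * y.1) = 0
      rw [← mul_assoc, (hx a).2, zero_mul]
  star_mem' := by
    intro x hx a
    have h := hx (star a)
    rw [← star_diag] at h
    constructor
    · have := congrArg star h.2
      simpa using! this
    · have := congrArg star h.1
      simpa using! this
  isClosed' := by
    have : {x : relComm ω A | ∀ a : A, x.1 * diag ω a = 0 ∧ diag ω a * x.1 = 0} =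
        ⋂ a : A, ({x | x.1 * diag ω a = 0} ∩ {x | diag ω a * x.1 = 0}) := by
      ext x
      simp
    change IsClosed {x : relComm ω A | ∀ a : A, x.1 * diag ω a = 0 ∧ diag ω a * x.1 = 0}
    rw [this]
    exact isClosed_iInter fun a => (isClosed_eq (by fun_prop) (by fun_prop)).inter
      (isClosed_eq (by fun_prop) (by fun_prop))

/-- Kirchberg's central sequence algebra `F_ω(A) = (A_ω ∩ A') / Ann(A)`. -/
abbrev CentralSeqAlg : Type _ := (annIdeal ω A).Quotient

variable {A}

/-- For `a ∈ A`, the map `F_ω(A) → A_ω` which sends the class of `x ∈ A_ω ∩ A'` to `a x`; it is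
well defined because `a` annihilates `Ann(A)`. -/
def leftMul (a : A) : CentralSeqAlg ω A →ₗ[ℂ] Ultrapower ω A :=
  (annIdeal ω A).toSubmodule.liftQ
    ((LinearMap.mulLeft ℂ (diag ω a)) ∘ₗ (relComm ω A).toSubmodule.subtype)
    (fun x hx => by simpa using! (hx a).2)

lemma leftMul_proj (a : A) (x : relComm ω A) :
    leftMul ω a ((annIdeal ω A).proj x) = diag ω a * x.1 := rfl

lemma leftMul_nonneg [PartialOrder A] [StarOrderedRing A] {a : A} (ha : 0 ≤ a)
    {e : CentralSeqAlg ω A} (he : 0 ≤ e) : 0 ≤ leftMul ω a e := by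
  obtain ⟨q, rfl⟩ := CStarAlgebra.nonneg_iff_eq_star_mul_self.1 he
  obtain ⟨y, rfl⟩ := (annIdeal ω A).proj_surjective q
  rw [← ClosedIdeal.proj_star, ← ClosedIdeal.proj_mul, leftMul_proj]
  have h : diag ω a * (star y * y : relComm ω A).1 = star y.1 * diag ω a * y.1 := by
    change diag ω a * (star y.1 * y.1) = _
    have h' : diag ω a * star y.1 = star y.1 * diag ω a := (mem_relComm ω).1 (star y).2 a
    rw [← mul_assoc, h']
  rw [h]
  exact star_left_conjugate_nonneg (diag_nonneg ω ha) _

end Ultrapower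

/-! ### Limit traces and the uniform tracial ultrapower -/

section UniformTracialUltrapower

variable (ω : Ultrafilter ℕ) (A : Type*) [NonUnitalCStarAlgebra A]

/-- The limit traces `T_ω(A)` on `A_ω`. -/
def limitTraces : Set (WeakDual ℂ (Ultrapower ω A)) :=
  {τ | τ ∈ tracialStates (Ultrapower ω A) ∧
    ∃ τs : ℕ → WeakDual ℂ A, (∀ n, τs n ∈ tracialStates A) ∧
      ∀ a : BddSeq A, Tendsto (fun n => τs n (a n)) ω (𝓝 (τ (ofSeq ω a)))}

open scoped ComplexOrder in
lemma boundedTrace_null_iff {B : Type*} [NonUnitalCStarAlgebra B] {φ : WeakDual ℂ B}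
    (hφ : φ ∈ boundedTraces B) (x : B) : φ (star x * x) = 0 ↔ ∀ y : B, φ (y * x) = 0 := by
  refine ⟨fun h y => ?_, fun h => h _⟩
  let _ := CStarAlgebra.spectralOrder B
  have := CStarAlgebra.spectralOrderedRing B
  let f : B →ₚ[ℂ] ℂ := PositiveLinearMap.mk₀ (φ : B →L[ℂ] ℂ).toLinearMap (by
    intro a ha
    obtain ⟨b, rfl⟩ := CStarAlgebra.nonneg_iff_eq_star_mul_self.1 ha
    exact hφ.1 b)
  have hf : ∀ b, f b = φ b := fun _ => rfl
  have h1 := norm_inner_le_norm (𝕜 := ℂ) (f.toPreGNS (star y)) (f.toPreGNS x)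
  have h2 : ‖f.toPreGNS x‖ = 0 := by
    rw [f.preGNS_norm_def, f.ofPreGNS_toPreGNS, hf, h]
    simp
  rw [h2, mul_zero, f.preGNS_inner_def, f.ofPreGNS_toPreGNS, f.ofPreGNS_toPreGNS, star_star, hf]
    at h1
  exact norm_le_zero_iff.1 h1

/-- The trace kernel ideal `J_A`. -/
def traceKernel : ClosedIdeal (Ultrapower ω A) where
  carrier := {x | ∀ τ ∈ limitTraces ω A, τ (star x * x) = 0}
  add_mem' := by
    intro x y hx hy τ hτ
    have h1 := (boundedTrace_null_iff hτ.1.1 x).1 (hx τ hτ)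
    have h2 := (boundedTrace_null_iff hτ.1.1 y).1 (hy τ hτ)
    refine (boundedTrace_null_iff hτ.1.1 _).2 fun z => ?_
    rw [mul_add, map_add, h1, h2, add_zero]
  zero_mem' := by
    intro τ _
    simp
  smul_mem' := by
    intro c x hx τ hτ
    have h1 := (boundedTrace_null_iff hτ.1.1 x).1 (hx τ hτ)
    refine (boundedTrace_null_iff hτ.1.1 _).2 fun z => ?_
    rw [mul_smul_comm, map_smul, h1, smul_zero]
  mul_left_mem' := by
    intro a x hx τ hτ
    have h1 := (boundedTrace_null_iff hτ.1.1 x).1 (hx τ hτ)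
    refine (boundedTrace_null_iff hτ.1.1 _).2 fun z => ?_
    rw [← mul_assoc, h1]
  mul_right_mem' := by
    intro a x hx τ hτ
    have h1 := (boundedTrace_null_iff hτ.1.1 x).1 (hx τ hτ)
    refine (boundedTrace_null_iff hτ.1.1 _).2 fun z => ?_
    rw [← mul_assoc, hτ.1.1.2, ← mul_assoc, h1]
  star_mem' := by
    intro x hx τ hτ
    rw [star_star, hτ.1.1.2]
    exact hx τ hτ
  isClosed' := by
    have : {x : Ultrapower ω A | ∀ τ ∈ limitTraces ω A, τ (star x * x) = 0} =
        ⋂ τ ∈ limitTraces ω A, {x | τ (star x * x) = 0} := by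
      ext x
      simp
    change IsClosed {x : Ultrapower ω A | ∀ τ ∈ limitTraces ω A, τ (star x * x) = 0}
    rw [this]
    exact isClosed_biInter fun τ _ => isClosed_eq
      ((map_continuous τ).comp (by fun_prop)) continuous_const

/-- The uniform tracial ultrapower `A^ω = A_ω / J_A`. -/
abbrev TracialUltrapower : Type _ := (traceKernel ω A).Quotient

/-- The tracial states on `A^ω` which come from limit traces. -/
def tracialLimitTraces : Set (WeakDual ℂ (TracialUltrapower ω A)) :=
  {σ | σ ∈ tracialStates (TracialUltrapower ω A) ∧
    ∃ τ ∈ limitTraces ω A, ∀ x : Ultrapower ω A, σ ((traceKernel ω A).proj x) = τ x}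

variable {A} in
/-- The canonical map `ι : A → A^ω`. -/
def tracialDiag (a : A) : TracialUltrapower ω A := (traceKernel ω A).proj (diag ω a)

/-- Uniform property Γ. -/
def HasUniformGamma : Prop :=
  ∀ n : ℕ, 0 < n → ∃ p : Fin n → TracialUltrapower ω A,
    (∀ i, IsStarProjection (p i)) ∧
    (∀ i, ∀ a : A, tracialDiag ω a * p i = p i * tracialDiag ω a) ∧
    (∀ y : TracialUltrapower ω A, (∑ i, p i) * y = y ∧ y * (∑ i, p i) = y) ∧
    ∀ a : A, ∀ σ ∈ tracialLimitTraces ω A, ∀ i,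
      σ (tracialDiag ω a * p i) = (1 / n : ℂ) * σ (tracialDiag ω a)

end UniformTracialUltrapower

/-! ### Generalised limit traces and stabilised property Γ -/

section StabilisedGamma

variable (ω : Ultrafilter ℕ) (A : Type*) [NonUnitalCStarAlgebra A] [PartialOrder A]
  [StarOrderedRing A]

/-- The generalised limit traces on `A_ω`: those induced by the formula
`(aₙ) ↦ sup_{ε > 0} lim_{n → ω} τₙ((aₙ - ε)₊)` for a sequence of lower semicontinuous
traces `τₙ` on `A`. (Limits along an ultrafilter always exist in `[0, ∞]`.) -/
def genLimitTraces : Set (ExtTrace (Ultrapower ω A)) :=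
  {τ | ∃ τs : ℕ → ExtTrace A, (∀ n, (τs n).IsLsc) ∧
    ∀ (a : BddSeq A) (ha : ∀ n, 0 ≤ a n),
      τ ⟨ofSeq ω a, ofSeq_nonneg ω a ha⟩ =
        ⨆ (ε : ℝ) (_ : 0 < ε), limUnder (ω : Filter ℕ) fun n => τs n (cutDown (a n) ε)}

variable {A}

/-- The trace `τ_a` on `F_ω(A)`: the class of `x ∈ A_ω ∩ A'` is sent to `τ(a x)`. -/
def inducedTrace (τ : ExtTrace (Ultrapower ω A)) (a : PosCone A)
    (e : PosCone (CentralSeqAlg ω A)) : ℝ≥0∞ :=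
  τ ⟨leftMul ω a.1 e.1, leftMul_nonneg ω a.2 e.2⟩

variable (A)

/-- Stabilised property Γ. -/
def HasStabilisedGamma : Prop :=
  ∀ n : ℕ, 0 < n → ∃ e : Fin n → PosCone (CentralSeqAlg ω A),
    (∀ i, ‖(e i).1‖ ≤ 1) ∧
    (∀ i j, i ≠ j → (e i).1 * (e j).1 = 0) ∧
    ∀ a : PosCone A, ∀ τ ∈ genLimitTraces ω A, τ ⟨diag ω a.1, diag_nonneg ω a.2⟩ < ∞ →
      ∀ i, inducedTrace ω τ a (e i) = (1 / n : ℝ≥0∞) * τ ⟨diag ω a.1, diag_nonneg ω a.2⟩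

end StabilisedGamma

end CStarGamma

end

/-!
The two notions of property Γ are compared through the canonical maps from `A_ω ∩ A'` to `F_ω(A)`
and to `A^ω ∩ A'`.

*Stabilised implies uniform.* Lift the `eᵢ` to positive contractions `xᵢ = cᵢ* cᵢ ∈ A_ω ∩ A'`, and
let `pᵢ` be the class of `xᵢ` in `A^ω`. Since `T(A)` is compact, there is a positive contraction of
`A` at which all limit traces are almost `1` (`exists_contraction_forall_trace_gt`). Hence the
annihilator of `A` dies in `A^ω` (`annIdeal_subset_traceKernel`), so that the `pᵢ` are pairwise
orthogonal. A limit trace `τ` is a generalised limit trace, so that `τ(a xᵢ) = τ(a) / n`, and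
`τ(xᵢ) = 1 / n` in the limit. With `s = ∑ xᵢ` one gets
`τ((1 - s)²) = 1 - 2 τ(s) + ∑ τ(xᵢ²) ≤ 1 - 2 + 1 = 0`: the `pᵢ` add up to the unit of `A^ω`, which,
by orthogonality, makes them projections. To work with `1 - s`, the limit traces are extended to the
unitization (`unitizeTrace`).

*Uniform implies stabilised.* Given the projections `pᵢ ∈ A^ω ∩ A'`, lift them to positive
contractions `xᵢ ∈ A_ω`, which commute with `A` and are orthogonal modulo the trace kernel ideal.
Replacing `xᵢ` by `(1 - e) xᵢ (1 - e)` with `e` far out in a quasicentral approximate unit of this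
ideal achieves these relations approximately, and countable saturation
(`exists_seq_of_forall_eventually`) gives lifts `yᵢ` satisfying them exactly
(`exists_central_orthogonal_lift`). The quasicentral approximate unit
(`ClosedIdeal.exists_quasicentral`) consists of the iterated square roots of a positive element `h`
of the ideal which is quasi-invariant, `u h u* ≤ C h`, under finitely many unitaries; by operator
monotonicity of the square root, `u h^α u* ≤ C^α h^α` with `C^α → 1` as `α → 0`.

The classes of the `yᵢ` in `F_ω(A)` satisfy the trace identity for all limit traces, and the
generalised limit traces which are finite at some non-zero `a ∈ A₊` are multiples of limit traces
(`genLimitTraces.exists_eq_smul_limitTrace`): a lower semicontinuous trace on the simple algebra `A`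
which is finite at a non-zero positive element is densely defined
(`ExtTrace.IsFinite.isDenselyDefined`), and hence bounded, by assumption or, in the unital case, by
`IsUnital.forall_finite`.
-/

noncomputable section

namespace CStarGamma

open Filter Topology
open scoped ENNReal

/-! ### Quasicentral approximate units -/

section Quasicentral

namespace ClosedIdeal

lemma isClosed_toSubalgebra {A : Type*} [NonUnitalCStarAlgebra A] (I : ClosedIdeal A) :
    IsClosed (I.toSubalgebra : Set A) := I.isClosed'

lemma sqrt_mem {A : Type*} [NonUnitalCStarAlgebra A] [PartialOrder A] [StarOrderedRing A]
    (I : ClosedIdeal A) {a : A} (ha : 0 ≤ a) (h : a ∈ I.toSubmodule) :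
    CFC.sqrt a ∈ I.toSubmodule := by
  rw [CFC.sqrt_eq_real_sqrt a ha]
  have : IsClosed (I.toSubalgebra : Set A) := I.isClosed_toSubalgebra
  exact cfcₙ_mem (s := I.toSubalgebra) (𝕜' := ℂ) _ h

end ClosedIdeal

variable {B : Type*} [CStarAlgebra B] [PartialOrder B] [StarOrderedRing B]

lemma unitary_conj_nonneg (u : unitary B) {k : B} (hk : 0 ≤ k) : 0 ≤ (u : B) * k * star (u : B) :=
  star_right_conjugate_nonneg hk _

lemma sqrt_unitary_conj (u : unitary B) {k : B} (hk : 0 ≤ k) :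
    CFC.sqrt ((u : B) * k * star (u : B)) = u * CFC.sqrt k * star (u : B) := by
  refine CFC.sqrt_unique ?_ (unitary_conj_nonneg u (CFC.sqrt_nonneg k))
  have hu : star (u : B) * u = 1 := Unitary.coe_star_mul_self u
  calc (u : B) * CFC.sqrt k * star (u : B) * (u * CFC.sqrt k * star (u : B))
      = u * CFC.sqrt k * (star (u : B) * u) * CFC.sqrt k * star (u : B) := by noncomm_ring
    _ = u * (CFC.sqrt k * CFC.sqrt k) * star (u : B) := by rw [hu]; noncomm_ring
    _ = _ := by rw [CFC.sqrt_mul_sqrt_self k hk]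

lemma sqrt_smul {c : ℝ} (hc : 0 ≤ c) {k : B} (hk : 0 ≤ k) :
    CFC.sqrt (c • k) = √c • CFC.sqrt k := by
  refine CFC.sqrt_unique ?_ (smul_nonneg (Real.sqrt_nonneg c) (CFC.sqrt_nonneg k))
  rw [smul_mul_smul_comm, Real.mul_self_sqrt hc, CFC.sqrt_mul_sqrt_self k hk]

/-- Since the square root is operator monotone, taking repeated square roots of a positive element
`h` with `u h u* ≤ C h` replaces the constant `C` by `C ^ (2 ^ -m)`, which tends to `1`. -/
lemma exists_iterated_sqrt (J : ClosedIdeal B) (U : Set (unitary B)) {C : ℝ} (hC : 0 ≤ C) {h : B}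
    (hJ : h ∈ J.toSubmodule) (h0 : 0 ≤ h) (h1 : h ≤ 1)
    (hU : ∀ u ∈ U, (u : B) * h * star (u : B) ≤ C • h) (m : ℕ) :
    ∃ k ∈ J.toSubmodule, 0 ≤ k ∧ k ≤ 1 ∧ k ^ 2 ^ m = h ∧
      ∀ u ∈ U, (u : B) * k * star (u : B) ≤ (C ^ ((1 / 2 : ℝ) ^ m)) • k := by
  induction m with
  | zero => exact ⟨h, hJ, h0, h1, by simp, by simpa using hU⟩
  | succ m ih =>
    obtain ⟨k, hkJ, hk0, hk1, hkm, hkU⟩ := ih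
    refine ⟨CFC.sqrt k, J.sqrt_mem hk0 hkJ, CFC.sqrt_nonneg k, ?_, ?_, fun u hu => ?_⟩
    · simpa using CFC.sqrt_le_sqrt k 1 hk1
    · rw [pow_succ', pow_mul, CFC.sq_sqrt k hk0, hkm]
    · have h2 := CFC.sqrt_le_sqrt _ _ (hkU u hu)
      rw [sqrt_unitary_conj u hk0, sqrt_smul (by positivity) hk0] at h2
      rwa [Real.sqrt_eq_rpow, ← Real.rpow_mul hC, ← pow_succ] at h2

lemma norm_le_of_neg_le_of_le {x : B} {c : ℝ} (hx : IsSelfAdjoint x) (hc : 0 ≤ c)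
    (h1 : x ≤ c • 1) (h2 : -x ≤ c • 1) : ‖x‖ ≤ c := by
  rw [← cfc_id ℝ x]
  refine norm_cfc_le hc fun t ht => ?_
  rw [← Algebra.algebraMap_eq_smul_one] at h1 h2
  rw [id, Real.norm_eq_abs, abs_le]
  have h3 := (le_algebraMap_iff_spectrum_le hx).1 h1 t ht
  have h4 : algebraMap ℝ B (-c) ≤ x := by
    rw [map_neg]; exact neg_le.1 h2
  exact ⟨(algebraMap_le_iff_le_spectrum hx).1 h4 t ht, h3⟩

/-- Quasi-invariance with a constant close to `1` gives a small commutator. -/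
lemma norm_commutator_unitary_le {c : ℝ} (hc : 1 ≤ c) (u : unitary B) {k : B} (hk0 : 0 ≤ k)
    (hk1 : k ≤ 1) (h1 : (u : B) * k * star (u : B) ≤ c • k)
    (h2 : star (u : B) * k * u ≤ c • k) : ‖k * u - u * k‖ ≤ c - 1 := by
  have hu : star (u : B) * u = 1 := Unitary.coe_star_mul_self u
  have hu' : (u : B) * star (u : B) = 1 := Unitary.coe_mul_star_self u
  have e1 : k * u - u * k = (k - u * k * star (u : B)) * u := by
    rw [sub_mul, mul_assoc (u * k : B), hu, mul_one]
  rw [e1, CStarRing.norm_mul_coe_unitary]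
  have hv0 := unitary_conj_nonneg u hk0
  have hv1 : (u : B) * k * star (u : B) ≤ 1 := by
    have := star_right_conjugate_le_conjugate hk1 (u : B)
    rwa [mul_one, hu'] at this
  have h3 : k ≤ c • ((u : B) * k * star (u : B)) := by
    have := star_right_conjugate_le_conjugate h2 (u : B)
    have e : (u : B) * (star (u : B) * k * u) * star (u : B) = k := by
      calc _ = ((u : B) * star (u : B)) * k * (u * star (u : B)) := by noncomm_ring
        _ = _ := by rw [hu', one_mul, mul_one]
    rw [e] at this
    simpa using this
  refine norm_le_of_neg_le_of_le ?_ (by linarith) ?_ ?_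
  · exact (IsSelfAdjoint.of_nonneg hk0).sub (IsSelfAdjoint.of_nonneg hv0)
  · calc k - u * k * star (u : B) ≤ (c - 1) • ((u : B) * k * star (u : B)) := by
          rw [sub_smul, one_smul]; exact sub_le_sub_right h3 _
      _ ≤ (c - 1) • 1 := smul_le_smul_of_nonneg_left hv1 (by linarith)
  · rw [neg_sub]
    calc u * k * star (u : B) - k ≤ (c - 1) • k := by
          rw [sub_smul, one_smul]; exact sub_le_sub_right h1 _
      _ ≤ (c - 1) • 1 := smul_le_smul_of_nonneg_left hk1 (by linarith)

lemma norm_one_sub_mul_pow_le {k : B} (hk0 : 0 ≤ k) (hk1 : k ≤ 1) (N : ℕ) :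
    ‖(1 - k) * k ^ N * (1 - k)‖ ≤ 1 / (N + 1) := by
  have hs : IsSelfAdjoint k := .of_nonneg hk0
  have e : (1 - k) * k ^ N * (1 - k) = cfc (fun t : ℝ => (1 - t) * t ^ N * (1 - t)) k := by
    rw [cfc_mul _ _ k, cfc_mul _ _ k, cfc_sub _ _ k, cfc_pow _ _ k, cfc_const_one ℝ k,
      cfc_id' ℝ k]
  rw [e]
  refine norm_cfc_le (by positivity) fun t ht => ?_
  have t0 : 0 ≤ t := spectrum_nonneg_of_nonneg hk0 ht
  have t1 : t ≤ 1 := by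
    have : k ≤ algebraMap ℝ B 1 := by simpa using hk1
    exact (le_algebraMap_iff_spectrum_le hs).1 this t ht
  have h1 : 0 ≤ 1 - t := by linarith
  rw [Real.norm_of_nonneg (by positivity), le_div_iff₀ (by positivity)]
  have h2 : (N + 1) * t ^ N ≤ ∑ i ∈ Finset.range (N + 1), t ^ i := by
    have : ∑ i ∈ Finset.range (N + 1), t ^ N ≤ ∑ i ∈ Finset.range (N + 1), t ^ i :=
      Finset.sum_le_sum fun i hi =>
        pow_le_pow_of_le_one t0 t1 (Nat.lt_succ_iff.1 (Finset.mem_range.1 hi))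
    simpa using this
  have h3 : (∑ i ∈ Finset.range (N + 1), t ^ i) * (1 - t) = 1 - t ^ (N + 1) :=
    geom_sum_mul_neg t (N + 1)
  have h4 : 0 ≤ t ^ (N + 1) := by positivity
  calc (1 - t) * t ^ N * (1 - t) * (N + 1) = ((N + 1) * t ^ N) * (1 - t) * (1 - t) := by ring
    _ ≤ (∑ i ∈ Finset.range (N + 1), t ^ i) * (1 - t) * (1 - t) := by gcongr
    _ ≤ 1 * 1 := by
      gcongr
      · rw [h3]; linarith
      · linarith
    _ = 1 := one_mul 1

/-- Any positive `h₀ ∈ J` is dominated by a multiple of some positive `h ∈ J` which is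
quasi-invariant under finitely many unitaries: `h` is a multiple of the solution `g` of
`g = h₀ + r ∑ᵤ u g u*`, with `r > 0` small. -/
lemma exists_quasiinvariant (J : ClosedIdeal B) (U : Finset (unitary B)) {h₀ : B}
    (hJ : h₀ ∈ J.toSubmodule) (h0 : 0 ≤ h₀) :
    ∃ h ∈ J.toSubmodule, ∃ C : ℝ, 1 ≤ C ∧ 0 ≤ h ∧ h ≤ 1 ∧ h₀ ≤ C • h ∧
      ∀ u ∈ U, (u : B) * h * star (u : B) ≤ C • h := by
  let Φ : B →L[ℂ] B := ∑ u ∈ U, ContinuousLinearMap.mulLeftRight ℂ B (u : B) (star (u : B))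
  have hΦ : ∀ x, Φ x = ∑ u ∈ U, (u : B) * x * star (u : B) := fun x => by
    simp [Φ]
  let r : ℝ := (‖Φ‖ + 1)⁻¹
  have hr : 0 < r := by positivity
  let T : B →L[ℂ] B := (r : ℂ) • Φ
  have hTx : ∀ x, T x = r • Φ x := fun x => by
    simp [T]
  have hT : ‖T‖ < 1 := by
    rw [norm_smul, Complex.norm_real, Real.norm_of_nonneg hr.le,
      inv_mul_lt_iff₀ (by positivity)]
    linarith
  have hT0 : ∀ x, 0 ≤ x → 0 ≤ T x := fun x hx => by
    rw [hTx, hΦ]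
    exact smul_nonneg hr.le (Finset.sum_nonneg fun u _ => unitary_conj_nonneg u hx)
  have hTJ : ∀ x ∈ J.toSubmodule, T x ∈ J.toSubmodule := fun x hx => by
    rw [hTx, hΦ, ← Complex.coe_smul]
    exact J.smul_mem _ (sum_mem fun u _ => J.mul_right_mem' _ (J.mul_left_mem' _ hx))
  have hsum := (summable_geometric_of_norm_lt_one hT).hasSum
  set S := ∑' n : ℕ, T ^ n with hS
  have hfix : S h₀ - T (S h₀) = h₀ := by
    have := congrArg (fun f : B →L[ℂ] B => f h₀) (mul_neg_geom_series T hT)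
    simpa [sub_mul] using this
  have hsum' : HasSum (fun n : ℕ => (T ^ n) h₀) (S h₀) :=
    hsum.mapL (ContinuousLinearMap.apply ℂ B h₀)
  have hn0 : ∀ n : ℕ, 0 ≤ (T ^ n) h₀ := fun n => by
    induction n with
    | zero => simpa using h0
    | succ n ih => rw [pow_succ']; exact hT0 _ ih
  have hnJ : ∀ n : ℕ, (T ^ n) h₀ ∈ J.toSubmodule := fun n => by
    induction n with
    | zero => simpa using hJ
    | succ n ih => rw [pow_succ']; exact hTJ _ ih
  have hg0 : 0 ≤ S h₀ := hsum'.nonneg hn0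
  have hgJ : S h₀ ∈ J.toSubmodule :=
    J.isClosed'.mem_of_tendsto hsum' (Eventually.of_forall fun s => sum_mem fun n _ => hnJ n)
  set g := S h₀
  have hg1 : h₀ ≤ g := by
    rw [← hfix]; exact sub_le_self _ (hT0 g hg0)
  have hg2 : T g ≤ g := by
    rw [← sub_nonneg, hfix]; exact h0
  let c : ℝ := (‖g‖ + 1)⁻¹
  have hc : 0 < c := by positivity
  refine ⟨c • g, ?_, (‖g‖ + 1) * (‖Φ‖ + 1), ?_, smul_nonneg hc.le hg0, ?_, ?_, fun u hu => ?_⟩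
  · rw [← Complex.coe_smul]; exact J.smul_mem _ hgJ
  · nlinarith [norm_nonneg g, norm_nonneg Φ]
  · refine (CStarAlgebra.norm_le_one_iff_of_nonneg _ (smul_nonneg hc.le hg0)).1 ?_
    rw [norm_smul, Real.norm_of_nonneg hc.le, inv_mul_le_iff₀ (by positivity)]
    linarith
  · rw [smul_smul, show (‖g‖ + 1) * (‖Φ‖ + 1) * c = ‖Φ‖ + 1 by simp only [c]; field_simp]
    calc h₀ ≤ (1 : ℝ) • g := by rwa [one_smul]
      _ ≤ _ := smul_le_smul_of_nonneg_right (by linarith [norm_nonneg Φ]) hg0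
  · have h1 : (u : B) * g * star (u : B) ≤ Φ g := by
      rw [hΦ]
      exact Finset.single_le_sum (f := fun u : unitary B => (u : B) * g * star (u : B))
        (fun v _ => unitary_conj_nonneg v hg0) hu
    have h2 : Φ g ≤ (‖Φ‖ + 1) • g := by
      have := smul_le_smul_of_nonneg_left hg2 (show 0 ≤ ‖Φ‖ + 1 by positivity)
      rwa [hTx, smul_smul, show (‖Φ‖ + 1) * r = 1 by simp only [r]; field_simp, one_smul] at this
    calc (u : B) * c • g * star (u : B) = c • ((u : B) * g * star (u : B)) := by
          rw [mul_smul_comm, smul_mul_assoc]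
      _ ≤ c • ((‖Φ‖ + 1) • g) := smul_le_smul_of_nonneg_left (h1.trans h2) hc.le
      _ ≤ ((‖g‖ + 1) * (‖Φ‖ + 1)) • c • g := by
          rw [smul_comm c, smul_smul, smul_smul]
          refine smul_le_smul_of_nonneg_right ?_ hg0
          gcongr
          nlinarith [norm_nonneg g, norm_nonneg Φ]

/-- The iterated square roots of a quasi-invariant `h` which dominates `∑ z z*` asymptotically
commute with the given unitaries and act as left units on the given elements of the ideal. -/
lemma exists_quasicentral_unitary (J : ClosedIdeal B) (U : Finset (unitary B)) (Z : Finset B)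
    (hZ : ∀ z ∈ Z, z ∈ J.toSubmodule) :
    ∃ e : ℕ → B, (∀ m, e m ∈ J.toSubmodule ∧ 0 ≤ e m ∧ e m ≤ 1) ∧
      (∀ u ∈ U, Tendsto (fun m => e m * (u : B) - u * e m) atTop (𝓝 0)) ∧
      ∀ z ∈ Z, Tendsto (fun m => z - e m * z) atTop (𝓝 0) := by
  classical
  obtain ⟨h, hJ, C, hC, h0, h1, hZh, hUh⟩ := exists_quasiinvariant J (U ∪ U.image star)
    (h₀ := ∑ z ∈ Z, z * star z) (sum_mem fun z hz => J.mul_right_mem' _ (hZ z hz))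
    (Finset.sum_nonneg fun z _ => mul_star_self_nonneg z)
  choose e heJ he0 he1 hem heU using
    exists_iterated_sqrt J (U ∪ U.image star : Finset (unitary B)) (by linarith) hJ h0 h1 hUh
  refine ⟨e, fun m => ⟨heJ m, he0 m, he1 m⟩, fun u hu => ?_, fun z hz => ?_⟩
  · have hlim : Tendsto (fun m : ℕ => C ^ ((1 / 2 : ℝ) ^ m) - 1) atTop (𝓝 0) := by
      have h2 : Tendsto (fun m : ℕ => (1 / 2 : ℝ) ^ m) atTop (𝓝 0) :=
        tendsto_pow_atTop_nhds_zero_of_lt_one (by norm_num) (by norm_num)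
      have h3 := (Real.continuousAt_const_rpow (a := C) (b := 0) (by linarith)).tendsto.comp h2
      simpa using h3.sub_const 1
    refine squeeze_zero_norm (fun m => ?_) hlim
    refine norm_commutator_unitary_le (Real.one_le_rpow hC (by positivity)) u (he0 m) (he1 m)
      (heU m u (by simp [hu])) ?_
    have := heU m (star u) (by
      simp only [Finset.coe_union, Finset.coe_image, Set.mem_union, Set.mem_image,
        Finset.mem_coe]
      exact Or.inr ⟨u, hu, rfl⟩)
    simpa using this
  · have hlim : Tendsto (fun m : ℕ => √(C * (1 / ((2 ^ m : ℕ) + 1)))) atTop (𝓝 0) := by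
      have h2 : Tendsto (fun n : ℕ => 1 / ((n : ℝ) + 1)) atTop (𝓝 0) :=
        tendsto_one_div_add_atTop_nhds_zero_nat
      have h3 := h2.comp (tendsto_pow_atTop_atTop_of_one_lt (r := 2) (by norm_num))
      have h4 := (Real.continuous_sqrt.tendsto _).comp (h3.const_mul C)
      simpa [Function.comp_def] using h4
    refine squeeze_zero_norm (fun m => ?_) hlim
    refine Real.le_sqrt_of_sq_le ?_
    have hs : star (1 - e m) = 1 - e m := by
      rw [star_sub, star_one, (IsSelfAdjoint.of_nonneg (he0 m)).star_eq]
    have e1 : z - e m * z = (1 - e m) * z := by noncomm_ring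
    have hle : z * star z ≤ C • h :=
      (Finset.single_le_sum (f := fun z : B => z * star z)
        (fun z _ => mul_star_self_nonneg z) hz).trans hZh
    have h5 : (1 - e m) * (z * star z) * (1 - e m) ≤ C • ((1 - e m) * h * (1 - e m)) := by
      have := star_right_conjugate_le_conjugate hle (1 - e m)
      rwa [hs, mul_smul_comm, smul_mul_assoc] at this
    have h6 : 0 ≤ (1 - e m) * (z * star z) * (1 - e m) := by
      have := star_right_conjugate_nonneg (mul_star_self_nonneg z) (1 - e m)
      rwa [hs] at this
    calc ‖z - e m * z‖ ^ 2 = ‖(1 - e m) * (z * star z) * (1 - e m)‖ := by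
          rw [e1, sq, ← CStarRing.norm_self_mul_star, star_mul, hs]
          simp only [mul_assoc]
      _ ≤ ‖C • ((1 - e m) * h * (1 - e m))‖ := CStarAlgebra.norm_le_norm_of_nonneg_of_le h6 h5
      _ = C * ‖(1 - e m) * (e m) ^ 2 ^ m * (1 - e m)‖ := by
          rw [norm_smul, Real.norm_of_nonneg (by linarith), hem m]
      _ ≤ _ := by
          have := norm_one_sub_mul_pow_le (he0 m) (he1 m) (2 ^ m)
          gcongr

end Quasicentral

/-- A closed ideal of `A` is a closed ideal of the unitization of `A`. -/
def ClosedIdeal.unitize {A : Type*} [NonUnitalCStarAlgebra A] (I : ClosedIdeal A) :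
    ClosedIdeal (Unitization ℂ A) where
  toSubmodule := I.toSubmodule.map (Unitization.inrHom ℂ ℂ A)
  mul_left_mem' := by
    rintro a _ ⟨x, hx, rfl⟩
    refine ⟨a.fst • x + a.snd * x, add_mem (I.smul_mem _ hx) (I.mul_left_mem' _ hx), ?_⟩
    ext <;> simp
  mul_right_mem' := by
    rintro a _ ⟨x, hx, rfl⟩
    refine ⟨a.fst • x + x * a.snd, add_mem (I.smul_mem _ hx) (I.mul_right_mem' _ hx), ?_⟩
    ext <;> simp
  star_mem' := by
    rintro _ ⟨x, hx, rfl⟩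
    refine ⟨star x, I.star_mem' hx, ?_⟩
    ext <;> simp
  isClosed' :=
    (Unitization.isometry_inr (𝕜 := ℂ) (A := A)).isClosedEmbedding.isClosedMap _ I.isClosed'

lemma ClosedIdeal.inr_mem_unitize {A : Type*} [NonUnitalCStarAlgebra A] (I : ClosedIdeal A) {x : A}
    (hx : x ∈ I.toSubmodule) : (x : Unitization ℂ A) ∈ I.unitize.toSubmodule := ⟨x, hx, rfl⟩

/-- A closed ideal has an approximate unit which is quasicentral: it asymptotically commutes with
any given finite subset of the ambient algebra. -/
lemma ClosedIdeal.exists_quasicentral {A : Type*} [NonUnitalCStarAlgebra A] [PartialOrder A]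
    [StarOrderedRing A] (I : ClosedIdeal A) (S Z : Finset A) (hZ : ∀ z ∈ Z, z ∈ I.toSubmodule) :
    ∃ e : ℕ → A, (∀ m, e m ∈ I.toSubmodule ∧ 0 ≤ e m ∧ ‖e m‖ ≤ 1) ∧
      (∀ s ∈ S, Tendsto (fun m => e m * s - s * e m) atTop (𝓝 0)) ∧
      ∀ z ∈ Z, Tendsto (fun m => z - e m * z) atTop (𝓝 0) := by
  classical
  have hspan : ∀ s : A, ∃ T : Finset (Unitization ℂ A), (T : Set (Unitization ℂ A)) ⊆
      unitary (Unitization ℂ A) ∧ (s : Unitization ℂ A) ∈ Submodule.span ℂ (T : Set _) := fun s =>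
    Submodule.mem_span_finite_of_mem_span
      (by rw [CStarAlgebra.span_unitary]; exact Submodule.mem_top)
  choose T hT hsT using hspan
  let V : Finset (unitary (Unitization ℂ A)) := (S.biUnion T).subtype (· ∈ unitary _)
  obtain ⟨f, hf, hfU, hfZ⟩ := exists_quasicentral_unitary I.unitize V
    (Z.image (fun z : A => (z : Unitization ℂ A))) (by
      intro w hw
      obtain ⟨z, hz, rfl⟩ := Finset.mem_image.1 hw
      exact I.inr_mem_unitize (hZ z hz))
  have hlift : ∀ m, ∃ x ∈ I.toSubmodule, (x : Unitization ℂ A) = f m := fun m => (hf m).1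
  choose e heI hef using hlift
  have hzero : ∀ g : ℕ → A, Tendsto (fun m => (g m : Unitization ℂ A)) atTop (𝓝 0) →
      Tendsto g atTop (𝓝 0) := fun g hg => by
    rw [tendsto_zero_iff_norm_tendsto_zero] at hg ⊢
    simpa [Unitization.norm_inr] using hg
  refine ⟨e, fun m => ⟨heI m, ?_, ?_⟩, fun s hs => hzero _ ?_, fun z hz => hzero _ ?_⟩
  · rw [← Unitization.inr_nonneg_iff, hef]; exact (hf m).2.1
  · rw [← Unitization.norm_inr (𝕜 := ℂ), hef]
    exact (CStarAlgebra.norm_le_one_iff_of_nonneg _ (hf m).2.1).2 (hf m).2.2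
  · let K : Submodule ℂ (Unitization ℂ A) :=
      { carrier := {s | Tendsto (fun m => f m * s - s * f m) atTop (𝓝 0)}
        add_mem' := by
          intro a b ha hb
          have := Tendsto.add ha hb
          rw [add_zero] at this
          refine this.congr fun m => ?_
          noncomm_ring
        zero_mem' := by simp
        smul_mem' := by
          intro c a ha
          have := Tendsto.const_smul ha c
          rw [smul_zero] at this
          refine this.congr fun m => ?_
          rw [smul_sub, mul_smul_comm, smul_mul_assoc] }
    have hK : Submodule.span ℂ (T s : Set (Unitization ℂ A)) ≤ K := by
      rw [Submodule.span_le]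
      intro u hu
      exact hfU ⟨u, hT s hu⟩ (by
        simp only [V, Finset.mem_subtype, Finset.mem_biUnion]
        exact ⟨s, hs, hu⟩)
    have := hK (hsT s)
    refine Tendsto.congr (fun m => ?_) this
    simp [← hef]
  · refine (hfZ z (Finset.mem_image_of_mem _ hz)).congr fun m => ?_
    simp [← hef]

/-! ### Tracial states -/

section BoundedTraces

open scoped ComplexOrder

variable {B : Type*} [NonUnitalCStarAlgebra B] [PartialOrder B] [StarOrderedRing B]

lemma boundedTraces.nonneg {φ : WeakDual ℂ B} (hφ : φ ∈ boundedTraces B) {a : B} (ha : 0 ≤ a) :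
    0 ≤ φ a := by
  obtain ⟨b, rfl⟩ := CStarAlgebra.nonneg_iff_eq_star_mul_self.1 ha
  exact hφ.1 b

lemma boundedTraces.re_nonneg {φ : WeakDual ℂ B} (hφ : φ ∈ boundedTraces B) {a : B}
    (ha : 0 ≤ a) : 0 ≤ (φ a).re :=
  (Complex.nonneg_iff.1 (boundedTraces.nonneg hφ ha)).1

lemma boundedTraces.ofReal_re {φ : WeakDual ℂ B} (hφ : φ ∈ boundedTraces B) {a : B}
    (ha : 0 ≤ a) : ((φ a).re : ℂ) = φ a :=
  Complex.ext rfl (Complex.nonneg_iff.1 (boundedTraces.nonneg hφ ha)).2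

lemma boundedTraces.re_mono {φ : WeakDual ℂ B} (hφ : φ ∈ boundedTraces B) {a b : B}
    (hab : a ≤ b) : (φ a).re ≤ (φ b).re := by
  have := boundedTraces.re_nonneg hφ (sub_nonneg.2 hab)
  rw [map_sub, Complex.sub_re] at this
  linarith

omit [PartialOrder B] [StarOrderedRing B] in
lemma boundedTraces.norm_mul_sq_le {φ : WeakDual ℂ B} (hφ : φ ∈ boundedTraces B) (x y : B) :
    ‖φ (star y * x)‖ ^ 2 ≤ (φ (star y * y)).re * (φ (star x * x)).re := by
  let _ := CStarAlgebra.spectralOrder B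
  have := CStarAlgebra.spectralOrderedRing B
  let f : B →ₚ[ℂ] ℂ := PositiveLinearMap.mk₀ (φ : B →L[ℂ] ℂ).toLinearMap
    (fun a ha => boundedTraces.nonneg hφ ha)
  have hf : ∀ b, f b = φ b := fun _ => rfl
  have h1 := norm_inner_le_norm (𝕜 := ℂ) (f.toPreGNS y) (f.toPreGNS x)
  rw [f.preGNS_inner_def, f.ofPreGNS_toPreGNS, f.ofPreGNS_toPreGNS, hf] at h1
  have h2 : ∀ z, ‖f.toPreGNS z‖ ^ 2 = (φ (star z * z)).re := fun z => by
    rw [f.preGNS_norm_def, f.ofPreGNS_toPreGNS, hf, Real.sq_sqrt (boundedTraces.re_nonneg hφ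
      (star_mul_self_nonneg z))]
  rw [← h2, ← h2, ← mul_pow]
  gcongr

omit [PartialOrder B] [StarOrderedRing B] in
lemma tracialStates.norm_apply_le {τ : WeakDual ℂ B} (hτ : τ ∈ tracialStates B) (a : B) :
    ‖τ a‖ ≤ ‖a‖ := by
  have := (WeakDual.toStrongDual τ).le_opNorm a
  rwa [hτ.2, one_mul] at this

omit [PartialOrder B] [StarOrderedRing B] in
lemma tracialStates.re_apply_le {τ : WeakDual ℂ B} (hτ : τ ∈ tracialStates B) (a : B) :
    (τ a).re ≤ ‖a‖ :=
  (Complex.re_le_norm _).trans (tracialStates.norm_apply_le hτ a)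

lemma mul_self_le_self {e : B} (h0 : 0 ≤ e) (h1 : ‖e‖ ≤ 1) : e * e ≤ e := by
  have hs : star (CFC.sqrt e) = CFC.sqrt e := (IsSelfAdjoint.of_nonneg (CFC.sqrt_nonneg e)).star_eq
  have h2 := CStarAlgebra.star_left_conjugate_le_norm_smul (a := CFC.sqrt e) (b := e)
    (IsSelfAdjoint.of_nonneg h0)
  rw [hs, CFC.sqrt_mul_sqrt_self e h0] at h2
  have h3 : CFC.sqrt e * e * CFC.sqrt e = e * e := by
    have hss := CFC.sqrt_mul_sqrt_self e h0
    calc CFC.sqrt e * e * CFC.sqrt e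
        = CFC.sqrt e * (CFC.sqrt e * CFC.sqrt e) * CFC.sqrt e := by rw [hss]
      _ = (CFC.sqrt e * CFC.sqrt e) * (CFC.sqrt e * CFC.sqrt e) := by simp only [mul_assoc]
      _ = e * e := by rw [hss]
  rw [h3] at h2
  calc e * e ≤ ‖e‖ • e := h2
    _ ≤ (1 : ℝ) • e := smul_le_smul_of_nonneg_right h1 h0
    _ = e := one_smul _ _

/-- A state attains its norm along the approximate unit, even after squaring. -/
lemma tracialStates.tendsto_sq {τ : WeakDual ℂ B} (hτ : τ ∈ tracialStates B) :
    Tendsto (fun f => (τ (f * f)).re) (CStarAlgebra.approximateUnit B) (𝓝 1) := by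
  have hu := CStarAlgebra.increasingApproximateUnit (A := B)
  refine tendsto_order.2 ⟨fun c hc => ?_, fun c hc => ?_⟩
  · obtain ⟨d, hcd, hd⟩ := exists_between hc
    by_cases hd0 : d < 0
    · filter_upwards [hu.eventually_star_eq] with f hf
      have := boundedTraces.re_nonneg hτ.1 (star_mul_self_nonneg f)
      rw [hf] at this
      linarith
    push Not at hd0
    obtain ⟨b, hb1, hb2⟩ : ∃ b : B, ‖b‖ ≤ 1 ∧ √d < ‖τ b‖ := by
      by_contra! hcon
      have : ‖WeakDual.toStrongDual τ‖ ≤ √d := by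
        refine ContinuousLinearMap.opNorm_le_of_unit_norm (𝕜 := ℂ) (Real.sqrt_nonneg d)
          fun x hx => hcon x hx.le
      rw [hτ.2] at this
      have h2 : √d < 1 := by rw [Real.sqrt_lt' one_pos]; simpa using hd
      linarith
    have ht : Tendsto (fun f => ‖τ (f * b)‖) (CStarAlgebra.approximateUnit B) (𝓝 ‖τ b‖) :=
      (((map_continuous τ).tendsto b).comp (hu.tendsto_mul_right b)).norm
    filter_upwards [ht.eventually (lt_mem_nhds hb2), hu.eventually_star_eq] with f hf hs
    have h1 := boundedTraces.norm_mul_sq_le hτ.1 b f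
    rw [hs] at h1
    have h2 : (τ (star b * b)).re ≤ 1 := by
      refine (tracialStates.re_apply_le hτ _).trans ?_
      rw [CStarRing.norm_star_mul_self]
      exact mul_le_one₀ hb1 (norm_nonneg b) hb1
    have h3 : 0 ≤ (τ (f * f)).re := by
      have := boundedTraces.re_nonneg hτ.1 (star_mul_self_nonneg f)
      rwa [hs] at this
    have h4 : d < ‖τ (f * b)‖ ^ 2 := by
      have := pow_lt_pow_left₀ hf (Real.sqrt_nonneg d) two_ne_zero
      rwa [Real.sq_sqrt hd0] at this
    nlinarith
  · filter_upwards [hu.eventually_norm] with f hf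
    refine lt_of_le_of_lt (tracialStates.re_apply_le hτ _) (lt_of_le_of_lt ?_ hc)
    exact (norm_mul_le _ _).trans (mul_le_one₀ hf (norm_nonneg _) hf)

/-- The extension of a functional to the unitization which takes the value `1` at the unit. -/
def unitizeTrace (τ : WeakDual ℂ B) : Unitization ℂ B →ₗ[ℂ] ℂ where
  toFun m := m.fst + τ m.snd
  map_add' m m' := by
    simp only [Unitization.fst_add, Unitization.snd_add, map_add]; ring
  map_smul' c m := by
    simp only [Unitization.fst_smul, Unitization.snd_smul, map_smul, RingHom.id_apply,
      smul_eq_mul]; ring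

omit [PartialOrder B] [StarOrderedRing B] in
@[simp] lemma unitizeTrace_one (τ : WeakDual ℂ B) : unitizeTrace τ 1 = 1 := by
  simp [unitizeTrace]

omit [PartialOrder B] [StarOrderedRing B] in
@[simp] lemma unitizeTrace_inr (τ : WeakDual ℂ B) (b : B) :
    unitizeTrace τ (b : Unitization ℂ B) = τ b := by
  simp [unitizeTrace]

omit [PartialOrder B] [StarOrderedRing B] in
lemma unitizeTrace_comm {τ : WeakDual ℂ B} (hτ : τ ∈ boundedTraces B) (m m' : Unitization ℂ B) :
    unitizeTrace τ (m * m') = unitizeTrace τ (m' * m) := by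
  simp only [unitizeTrace, LinearMap.coe_mk, AddHom.coe_mk, Unitization.fst_mul,
    Unitization.snd_mul, map_add, map_smul, hτ.2 m.snd m'.snd]
  ring_nf

omit [PartialOrder B] [StarOrderedRing B] in
/-- The extension of a tracial state to the unitization is positive: its value at `m` is the limit
of `τ(f m f)` along an approximate unit. -/
lemma unitizeTrace_re_nonneg {τ : WeakDual ℂ B} (hτ : τ ∈ tracialStates B) {m : Unitization ℂ B}
    (hm : 0 ≤ m) : 0 ≤ (unitizeTrace τ m).re := by
  let _ := CStarAlgebra.spectralOrder B
  have := CStarAlgebra.spectralOrderedRing B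
  have hu := CStarAlgebra.increasingApproximateUnit (A := B)
  have key : ∀ f : B, f * (m.fst • f + m.snd * f) = m.fst • (f * f) + f * (m.snd * f) := by
    intro f; rw [mul_add, mul_smul_comm]
  have hlim : Tendsto (fun f : B => (τ (f * (m.fst • f + m.snd * f))).re)
      (CStarAlgebra.approximateUnit B) (𝓝 (unitizeTrace τ m).re) := by
    have h1 : Tendsto (fun f : B => m.fst * τ (f * f)) (CStarAlgebra.approximateUnit B)
        (𝓝 (m.fst * 1)) := by
      refine Tendsto.const_mul _ ?_
      have h2 := (Complex.continuous_ofReal.tendsto _).comp (tracialStates.tendsto_sq hτ)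
      rw [Complex.ofReal_one] at h2
      refine h2.congr' ?_
      filter_upwards [hu.eventually_star_eq] with f hf
      have h3 := boundedTraces.ofReal_re hτ.1 (star_mul_self_nonneg f)
      rwa [hf] at h3
    have h4 : Tendsto (fun f : B => τ (f * (m.snd * f))) (CStarAlgebra.approximateUnit B)
        (𝓝 (τ m.snd)) := by
      have h5 : Tendsto (fun f : B => f * (m.snd * f)) (CStarAlgebra.approximateUnit B)
          (𝓝 m.snd) := by
        have h6 := hu.tendsto_mul_right m.snd
        have h7 := hu.tendsto_mul_left m.snd
        rw [tendsto_iff_norm_sub_tendsto_zero] at h6 h7 ⊢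
        have h8 := h6.add h7
        rw [add_zero] at h8
        refine squeeze_zero' (Eventually.of_forall fun f => norm_nonneg _) ?_ h8
        filter_upwards [hu.eventually_norm] with f hf
        have h9 : f * (m.snd * f) - m.snd = (f * m.snd - m.snd) + f * (m.snd * f - m.snd) := by
          noncomm_ring
        rw [h9]
        refine (norm_add_le _ _).trans ?_
        gcongr
        refine (norm_mul_le _ _).trans ?_
        exact mul_le_of_le_one_left (norm_nonneg _) hf
      exact ((map_continuous τ).tendsto _).comp h5
    have h10 := (Complex.continuous_re.tendsto _).comp (h1.add h4)
    rw [mul_one] at h10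
    refine h10.congr fun f => ?_
    simp only [Function.comp_apply, key, map_add, map_smul, smul_eq_mul]
  refine ge_of_tendsto hlim ?_
  filter_upwards [hu.eventually_star_eq] with f hf
  refine boundedTraces.re_nonneg hτ.1 ?_
  rw [← Unitization.inr_nonneg_iff]
  have h1 := star_left_conjugate_nonneg hm (f : Unitization ℂ B)
  have h2 : star (f : Unitization ℂ B) * m * f =
      ((f * (m.fst • f + m.snd * f) : B) : Unitization ℂ B) := by
    rw [← Unitization.inr_star, hf]
    ext <;> simp [mul_add, mul_smul_comm, mul_assoc]
  rwa [h2] at h1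

omit [PartialOrder B] [StarOrderedRing B] in
lemma unitizeTrace_re_mono {τ : WeakDual ℂ B} (hτ : τ ∈ tracialStates B) {m m' : Unitization ℂ B}
    (hm : m ≤ m') : (unitizeTrace τ m).re ≤ (unitizeTrace τ m').re := by
  have := unitizeTrace_re_nonneg hτ (sub_nonneg.2 hm)
  rw [map_sub, Complex.sub_re] at this
  linarith

omit [PartialOrder B] [StarOrderedRing B] in
/-- `τ(c* m c) ≤ ‖c‖² τ(m)` for a tracial state `τ`, where `m ≥ 0` may lie in the unitization. -/
lemma unitizeTrace_conj_le {τ : WeakDual ℂ B} (hτ : τ ∈ tracialStates B) {m : Unitization ℂ B}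
    (hm : 0 ≤ m) (c : Unitization ℂ B) :
    (unitizeTrace τ (star c * m * c)).re ≤ ‖c‖ ^ 2 * (unitizeTrace τ m).re := by
  set s := CFC.sqrt m
  have hs : star s = s := (IsSelfAdjoint.of_nonneg (CFC.sqrt_nonneg m)).star_eq
  have hss : s * s = m := CFC.sqrt_mul_sqrt_self m hm
  have e1 : unitizeTrace τ (star c * m * c) = unitizeTrace τ (s * (c * star c) * s) := by
    rw [← hss, show star c * (s * s) * c = (star c * s) * (s * c) by simp only [mul_assoc],
      unitizeTrace_comm hτ.1]
    simp only [mul_assoc]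
  have h1 := CStarAlgebra.star_left_conjugate_le_norm_smul (a := s) (b := c * star c)
    (IsSelfAdjoint.mul_star_self c)
  rw [hs, hss, CStarRing.norm_self_mul_star, ← sq] at h1
  rw [e1]
  refine (unitizeTrace_re_mono hτ h1).trans_eq ?_
  rw [← Complex.coe_smul, map_smul, smul_eq_mul, Complex.re_ofReal_mul]

/-- If the tracial states form a compact set, then they are all close to `1` at a single positive
contraction (Dini's theorem for an approximate unit). -/
lemma exists_contraction_forall_trace_gt (hc : IsCompact (tracialStates B)) {ε : ℝ} (hε : 0 < ε) :
    ∃ e : B, 0 ≤ e ∧ ‖e‖ ≤ 1 ∧ ∀ τ ∈ tracialStates B, 1 - ε < (τ e).re := by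
  have hu := CStarAlgebra.increasingApproximateUnit (A := B)
  have hP : ∀ K : Set (WeakDual ℂ B), IsCompact K → K ⊆ tracialStates B →
      ∀ᶠ e in CStarAlgebra.approximateUnit B, ∀ τ ∈ K, 1 - ε < (τ e).re := by
    intro K hK hKT
    refine hK.induction_on (p := fun K => ∀ᶠ e in CStarAlgebra.approximateUnit B,
      ∀ τ ∈ K ∩ tracialStates B, 1 - ε < (τ e).re) (by simp) ?_ ?_ ?_ |>.mono
        fun e he τ hτ => he τ ⟨hτ, hKT hτ⟩
    · intro s t hst ht
      filter_upwards [ht] with e he τ hτ using he τ ⟨hst hτ.1, hτ.2⟩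
    · intro s t hs ht
      filter_upwards [hs, ht] with e h1 h2 τ hτ
      rcases hτ.1 with h | h
      exacts [h1 τ ⟨h, hτ.2⟩, h2 τ ⟨h, hτ.2⟩]
    · intro τ hτ
      obtain ⟨f, hf, hf0, hf1⟩ : ∃ f : B, 1 - ε < (τ f).re ∧ 0 ≤ f ∧ ‖f‖ < 1 := by
        have h1 := (tracialStates.tendsto_sq (hKT hτ)).eventually
          (lt_mem_nhds (show 1 - ε / 2 < 1 by linarith))
        obtain ⟨f, hf, hf0, hf1⟩ := (h1.and (hu.eventually_nonneg.and hu.eventually_norm)).exists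
        have h2 := boundedTraces.re_mono (hKT hτ).1 (mul_self_le_self hf0 hf1)
        have h3 := tracialStates.re_apply_le (hKT hτ) f
        -- the sections `{e | f ≤ e}` belong to the filter only for `‖f‖ < 1`, so `f` is scaled down
        let r : ℝ := 1 / (1 + ε / 4)
        have hr : 0 < r := by positivity
        have hr1 : r < 1 := by
          rw [div_lt_one (by positivity)]; linarith
        have hr2 : 1 - ε / 4 ≤ r := by
          rw [le_div_iff₀ (by positivity)]; nlinarith
        refine ⟨(r : ℂ) • f, ?_, ?_, ?_⟩
        · rw [map_smul, smul_eq_mul, Complex.re_ofReal_mul]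
          have : 0 ≤ (τ f).re := boundedTraces.re_nonneg (hKT hτ).1 hf0
          nlinarith
        · rw [Complex.coe_smul]; exact smul_nonneg hr.le hf0
        · rw [norm_smul, Complex.norm_real, Real.norm_of_nonneg hr.le]
          nlinarith [norm_nonneg f]
      refine ⟨{σ | 1 - ε < (σ f).re}, mem_nhdsWithin_of_mem_nhds ?_, ?_⟩
      · refine IsOpen.mem_nhds ?_ hf
        exact isOpen_lt continuous_const
          (Complex.continuous_re.comp (WeakDual.eval_continuous f))
      · filter_upwards [(CStarAlgebra.hasBasis_approximateUnit B).mem_of_mem ⟨hf0, hf1⟩]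
          with e he σ hσ
        exact lt_of_lt_of_le hσ.1 (boundedTraces.re_mono hσ.2.1 he.1)
  obtain ⟨e, he, he0, he1⟩ := ((hP _ hc subset_rfl).and
    (hu.eventually_nonneg.and hu.eventually_norm)).exists
  exact ⟨e, he0, he1, he⟩

end BoundedTraces

/-! ### Lifting along quotient maps -/

namespace ClosedIdeal

variable {A : Type*} [NonUnitalCStarAlgebra A] (I : ClosedIdeal A)

/-- The quotient map as a `*`-homomorphism. -/
def projHom : A →⋆ₙₐ[ℂ] I.Quotient where
  toFun := I.proj
  map_smul' := I.proj.map_smul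
  map_zero' := I.proj.map_zero
  map_add' := I.proj.map_add
  map_mul' := I.proj_mul
  map_star' := I.proj_star

lemma proj_eq_zero {a : A} : I.proj a = 0 ↔ a ∈ I.toSubmodule :=
  Submodule.Quotient.mk_eq_zero I.toSubmodule

lemma continuous_proj : Continuous I.proj :=
  AddMonoidHomClass.continuous_of_bound I.proj 1 fun a => by
    simpa using I.norm_proj_le a

/-- A self-adjoint contraction lifts to a self-adjoint contraction: truncate any lift. -/
lemma exists_selfAdjoint_lift {q : I.Quotient} (hq : IsSelfAdjoint q) (hq1 : ‖q‖ ≤ 1) :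
    ∃ c : A, IsSelfAdjoint c ∧ ‖c‖ ≤ 1 ∧ I.proj c = q := by
  obtain ⟨l, hl⟩ := I.proj_surjective q
  let x : A := (1 / 2 : ℂ) • (l + star l)
  have hx : IsSelfAdjoint x := by
    have : IsSelfAdjoint (1 / 2 : ℂ) := by simp [isSelfAdjoint_iff]
    exact this.smul (IsSelfAdjoint.add_star_self l)
  have hxq : I.proj x = q := by
    simp only [x, map_smul, map_add, proj_star, hl, hq.star_eq]
    rw [← two_smul ℂ q, smul_smul]
    norm_num
  let f : ℝ → ℝ := fun t => max (-1) (min t 1)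
  have hf : Continuous f := by fun_prop
  have hf0 : f 0 = 0 := by simp [f]
  have hf1 : ∀ t, ‖f t‖ ≤ 1 := fun t => by
    rw [Real.norm_eq_abs, abs_le]
    exact ⟨le_max_left _ _, max_le (by norm_num) (min_le_right _ _)⟩
  refine ⟨cfcₙ f x, cfcₙ_predicate f x, norm_cfcₙ_le fun t _ => hf1 t, ?_⟩
  have h1 := I.projHom.map_cfcₙ f x (hf.continuousOn) hf0 I.continuous_proj hx
    (by change IsSelfAdjoint (I.proj x); rwa [hxq])
  change I.proj (cfcₙ f x) = cfcₙ f (I.proj x) at h1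
  rw [h1, hxq]
  conv_rhs => rw [← cfcₙ_id ℝ q]
  refine cfcₙ_congr fun t ht => ?_
  have h2 : ‖t‖ ≤ ‖cfcₙ (id : ℝ → ℝ) q‖ := norm_apply_le_norm_cfcₙ (id : ℝ → ℝ) q ht
  rw [cfcₙ_id ℝ q, Real.norm_eq_abs] at h2
  have h3 := abs_le.1 (h2.trans hq1)
  simp only [f, id, min_eq_left h3.2, max_eq_right h3.1]

lemma exists_positive_lift {q : I.Quotient} (hq : 0 ≤ q) (hq1 : ‖q‖ ≤ 1) :
    ∃ c : A, ‖c‖ ≤ 1 ∧ I.proj (star c * c) = q := by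
  have hs := IsSelfAdjoint.of_nonneg (CFC.sqrt_nonneg q)
  have hn : ‖CFC.sqrt q‖ ≤ 1 := by
    have h1 : ‖CFC.sqrt q‖ * ‖CFC.sqrt q‖ = ‖q‖ := by
      rw [← CStarRing.norm_star_mul_self, hs.star_eq, CFC.sqrt_mul_sqrt_self q hq]
    nlinarith [norm_nonneg (CFC.sqrt q)]
  obtain ⟨c, hc, hc1, hcq⟩ := I.exists_selfAdjoint_lift hs hn
  exact ⟨c, hc1, by rw [hc.star_eq, proj_mul, hcq, CFC.sqrt_mul_sqrt_self q hq]⟩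

/-- A bounded functional which vanishes on a closed ideal descends to the quotient. -/
lemma exists_descend (φ : A →L[ℂ] ℂ) (hφ : ∀ x ∈ I.toSubmodule, φ x = 0) :
    ∃ ψ : I.Quotient →L[ℂ] ℂ, (∀ x, ψ (I.proj x) = φ x) ∧ ‖ψ‖ ≤ ‖φ‖ := by
  let ψ₀ : I.Quotient →ₗ[ℂ] ℂ := I.toSubmodule.liftQ φ.toLinearMap fun x hx => hφ x hx
  have h0 : ∀ x, ψ₀ (I.proj x) = φ x := fun x => rfl
  have hb : ∀ q, ‖ψ₀ q‖ ≤ ‖φ‖ * ‖q‖ := by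
    intro q
    have hlim : Tendsto (fun ε : ℝ => ‖φ‖ * (‖q‖ + ε)) (𝓝[>] 0) (𝓝 (‖φ‖ * (‖q‖ + 0))) := by
      have : Continuous fun ε : ℝ => ‖φ‖ * (‖q‖ + ε) := by fun_prop
      exact (this.tendsto 0).mono_left nhdsWithin_le_nhds
    rw [add_zero] at hlim
    refine ge_of_tendsto hlim ?_
    filter_upwards [self_mem_nhdsWithin] with ε hε
    obtain ⟨a, rfl, ha⟩ := I.exists_lift_norm_lt q hε
    rw [h0]
    exact (φ.le_opNorm a).trans (by gcongr)
  exact ⟨ψ₀.mkContinuous ‖φ‖ hb, h0, ψ₀.mkContinuous_norm_le (norm_nonneg φ) hb⟩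

open scoped ComplexOrder in
/-- A tracial state which vanishes on a closed ideal descends to a tracial state on the
quotient. -/
lemma exists_tracialState_descend {τ : WeakDual ℂ A} (hτ : τ ∈ tracialStates A)
    (h0 : ∀ x ∈ I.toSubmodule, τ x = 0) :
    ∃ σ ∈ tracialStates I.Quotient, ∀ x, σ (I.proj x) = τ x := by
  obtain ⟨ψ, hψ, hn⟩ := I.exists_descend (WeakDual.toStrongDual τ) h0
  have hψ' : ∀ x, ψ (I.proj x) = τ x := hψ
  refine ⟨StrongDual.toWeakDual ψ, ⟨⟨fun q => ?_, fun p q => ?_⟩, ?_⟩, hψ'⟩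
  · obtain ⟨x, rfl⟩ := I.proj_surjective q
    change _ ≤ ψ _
    rw [← proj_star, ← proj_mul, hψ']
    exact hτ.1.1 x
  · obtain ⟨x, rfl⟩ := I.proj_surjective p
    obtain ⟨y, rfl⟩ := I.proj_surjective q
    change ψ _ = ψ _
    rw [← proj_mul, ← proj_mul, hψ', hψ', hτ.1.2]
  · change ‖ψ‖ = 1
    rw [hτ.2] at hn
    refine le_antisymm hn ?_
    rw [← hτ.2]
    refine ContinuousLinearMap.opNorm_le_bound _ (norm_nonneg ψ) fun x => ?_
    rw [← hψ]
    exact (ψ.le_opNorm _).trans (by gcongr; exact I.norm_proj_le x)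

end ClosedIdeal

/-! ### Representing sequences in the ultrapower -/

section Sequences

variable {ω : Ultrafilter ℕ} {A : Type*} [NonUnitalCStarAlgebra A]

lemma ofSeq_mul (a b : BddSeq A) : ofSeq ω (a * b) = ofSeq ω a * ofSeq ω b := rfl

lemma ofSeq_add (a b : BddSeq A) : ofSeq ω (a + b) = ofSeq ω a + ofSeq ω b :=
  map_add (nullIdeal ω A).proj a b

lemma ofSeq_sub (a b : BddSeq A) : ofSeq ω (a - b) = ofSeq ω a - ofSeq ω b :=
  map_sub (nullIdeal ω A).proj a b

lemma ofSeq_smul (c : ℂ) (a : BddSeq A) : ofSeq ω (c • a) = c • ofSeq ω a :=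
  map_smul (nullIdeal ω A).proj c a

lemma ofSeq_surjective : Function.Surjective (ofSeq ω : BddSeq A → Ultrapower ω A) :=
  (nullIdeal ω A).proj_surjective

lemma ofSeq_eq_zero_iff {a : BddSeq A} :
    ofSeq ω a = 0 ↔ Tendsto (fun n => ‖a n‖) ω (𝓝 0) :=
  (nullIdeal ω A).proj_eq_zero

lemma norm_ofSeq_le (a : BddSeq A) : ‖ofSeq ω a‖ ≤ ‖a‖ := (nullIdeal ω A).norm_proj_le a

lemma norm_seq_apply_le (a : BddSeq A) (n : ℕ) : ‖a n‖ ≤ ‖a‖ :=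
  lp.norm_apply_le_norm ENNReal.top_ne_zero a n

/-- The bounded sequence with given terms. -/
def mkSeq (a : ℕ → A) (C : ℝ) (h : ∀ n, ‖a n‖ ≤ C) : BddSeq A :=
  ⟨a, memℓp_infty ⟨C, by rintro _ ⟨n, rfl⟩; exact h n⟩⟩

lemma eventually_norm_lt {a : BddSeq A} {ε : ℝ} (h : ‖ofSeq ω a‖ < ε) :
    ∀ᶠ n in (ω : Filter ℕ), ‖a n‖ < ε := by
  obtain ⟨b, hb, hbn⟩ := (nullIdeal ω A).exists_lift_norm_lt (ofSeq ω a)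
    (show 0 < (ε - ‖ofSeq ω a‖) / 2 by linarith)
  have h1 : Tendsto (fun n => ‖(a - b) n‖) ω (𝓝 0) := by
    rw [← ofSeq_eq_zero_iff, ofSeq_sub, sub_eq_zero]; exact hb.symm
  filter_upwards [h1.eventually (gt_mem_nhds (show 0 < (ε - ‖ofSeq ω a‖) / 2 by linarith))]
    with n hn
  have h2 := norm_seq_apply_le b n
  have h3 : ‖a n‖ ≤ ‖(a - b) n‖ + ‖b n‖ := by
    simpa using norm_add_le (a n - b n) (b n)
  linarith

lemma norm_diag_le (a : A) : ‖diag ω a‖ ≤ ‖a‖ :=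
  (norm_ofSeq_le _).trans (lp.norm_le_of_forall_le (norm_nonneg a) fun _ => le_rfl)

lemma diag_sub (a b : A) : diag ω (a - b) = diag ω a - diag ω b := by
  rw [diag, diag, diag, ← ofSeq_sub]
  rfl

lemma continuous_diag : Continuous (diag ω : A → Ultrapower ω A) := by
  refine continuous_iff_continuousAt.2 fun a => ?_
  rw [ContinuousAt, tendsto_iff_norm_sub_tendsto_zero]
  have h := tendsto_iff_norm_sub_tendsto_zero.1 (tendsto_id (α := A) (x := 𝓝 a))
  refine squeeze_zero (fun _ => norm_nonneg _) (fun b => ?_) h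
  rw [← diag_sub]
  exact norm_diag_le _

variable [PartialOrder A] [StarOrderedRing A]

lemma exists_nonneg_seq {x : Ultrapower ω A} (hx : 0 ≤ x) :
    ∃ a : BddSeq A, (∀ n, 0 ≤ a n) ∧ ofSeq ω a = x := by
  obtain ⟨y, rfl⟩ := CStarAlgebra.nonneg_iff_eq_star_mul_self.1 hx
  obtain ⟨b, rfl⟩ := ofSeq_surjective y
  exact ⟨star b * b, fun n => star_mul_self_nonneg (b n), rfl⟩

lemma exists_nonneg_contraction_seq {x : Ultrapower ω A} (hx : 0 ≤ x) (hx1 : ‖x‖ ≤ 1) :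
    ∃ a : BddSeq A, (∀ n, 0 ≤ a n ∧ ‖a n‖ ≤ 1) ∧ ofSeq ω a = x := by
  obtain ⟨c, hc, rfl⟩ := (nullIdeal ω A).exists_positive_lift hx hx1
  refine ⟨star c * c, fun n => ⟨star_mul_self_nonneg (c n), ?_⟩, rfl⟩
  change ‖star (c n) * c n‖ ≤ 1
  rw [CStarRing.norm_star_mul_self]
  have := (norm_seq_apply_le c n).trans hc
  exact mul_le_one₀ this (norm_nonneg _) this

end Sequences

/-- Countable saturation: if each of countably many, successively stronger, conditions can be met
along `ω`, then a single sequence meets all of them along `ω`. -/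
lemma exists_seq_of_forall_eventually {ω : Ultrafilter ℕ}
    (hω : (ω : Filter ℕ) ≤ Filter.cofinite) {X : Type*} [Nonempty X] (P : ℕ → ℕ → X → Prop)
    (hP : ∀ ⦃N M : ℕ⦄, N ≤ M → ∀ k x, P M k x → P N k x)
    (h : ∀ N, ∀ᶠ k in (ω : Filter ℕ), ∃ x, P N k x) :
    ∃ y : ℕ → X, ∀ N, ∀ᶠ k in (ω : Filter ℕ), P N k (y k) := by
  classical
  let M : ℕ → ℕ := fun k => Nat.findGreatest (fun N => ∃ x, P N k x) k
  have hy : ∀ k, ∃ x, (∃ N x, N ≤ k ∧ P N k x) → P (M k) k x := by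
    intro k
    by_cases hk : ∃ N x, N ≤ k ∧ P N k x
    · obtain ⟨N, x, hN, hx⟩ := hk
      obtain ⟨y, hy⟩ := Nat.findGreatest_spec (P := fun N => ∃ x, P N k x) hN ⟨x, hx⟩
      exact ⟨y, fun _ => hy⟩
    · exact ⟨Classical.arbitrary X, fun h => absurd h hk⟩
  choose y hy using hy
  refine ⟨y, fun N => ?_⟩
  have hge : ∀ᶠ k in (ω : Filter ℕ), N ≤ k := by
    have : ∀ᶠ k in (Filter.cofinite : Filter ℕ), N ≤ k := by
      rw [Nat.cofinite_eq_atTop]; exact eventually_ge_atTop N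
    exact hω this
  filter_upwards [h N, hge] with k ⟨x, hx⟩ hk
  exact hP (Nat.le_findGreatest hk ⟨x, hx⟩) k _ (hy k ⟨N, x, hk, hx⟩)

/-! ### Limit traces and the trace kernel ideal -/

section LimitTraces

open scoped ComplexOrder

variable {ω : Ultrafilter ℕ} {A : Type*} [NonUnitalCStarAlgebra A]

lemma exists_tendsto_of_norm_le {f : ℕ → ℂ} {C : ℝ} (h : ∀ n, ‖f n‖ ≤ C) :
    ∃ z, Tendsto f ω (𝓝 z) := by
  have hK : IsCompact (Metric.closedBall (0 : ℂ) C) := isCompact_closedBall 0 C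
  obtain ⟨z, -, hz⟩ := hK.ultrafilter_le_nhds (ω.map f) (by
    rw [Ultrafilter.coe_map, le_principal_iff]
    exact Filter.mem_map.2 (Filter.univ_mem' fun n => by simpa using h n))
  exact ⟨z, hz⟩

/-- If the set of tracial states is compact, then any sequence of tracial states induces a limit
trace. Compactness ensures that the limit has norm `1`. -/
lemma exists_limitTrace (hc : IsCompact (tracialStates A)) {τs : ℕ → WeakDual ℂ A}
    (hτs : ∀ n, τs n ∈ tracialStates A) :
    ∃ τ ∈ limitTraces ω A, ∀ a : BddSeq A,
      Tendsto (fun n => τs n (a n)) ω (𝓝 (τ (ofSeq ω a))) := by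
  let _ := CStarAlgebra.spectralOrder A
  have := CStarAlgebra.spectralOrderedRing A
  have hb : ∀ (a : BddSeq A) n, ‖τs n (a n)‖ ≤ ‖a‖ := fun a n =>
    (tracialStates.norm_apply_le (hτs n) _).trans (norm_seq_apply_le a n)
  have hex : ∀ a : BddSeq A, ∃ z, Tendsto (fun n => τs n (a n)) ω (𝓝 z) := fun a =>
    exists_tendsto_of_norm_le (hb a)
  choose L hL using hex
  let Λ₀ : BddSeq A →ₗ[ℂ] ℂ :=
    { toFun := L
      map_add' := fun a b => tendsto_nhds_unique (hL (a + b)) (by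
        simpa using (hL a).add (hL b))
      map_smul' := fun c a => tendsto_nhds_unique (hL (c • a)) (by
        simpa using (hL a).const_mul c) }
  have hΛb : ∀ a, ‖Λ₀ a‖ ≤ 1 * ‖a‖ := fun a => by
    rw [one_mul]
    exact le_of_tendsto (hL a).norm (Eventually.of_forall (hb a))
  let Λ : BddSeq A →L[ℂ] ℂ := Λ₀.mkContinuous 1 hΛb
  have hΛ : ∀ a, Λ a = L a := fun _ => rfl
  obtain ⟨ψ, hψ, hψn⟩ := (nullIdeal ω A).exists_descend Λ (fun a ha => by
    refine tendsto_nhds_unique (hL a) (squeeze_zero_norm (fun n => ?_) ha)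
    exact tracialStates.norm_apply_le (hτs n) _)
  have hlim : ∀ a : BddSeq A, Tendsto (fun n => τs n (a n)) ω (𝓝 (ψ (ofSeq ω a))) := fun a => by
    have : ψ (ofSeq ω a) = L a := hψ a
    rw [this]; exact hL a
  refine ⟨StrongDual.toWeakDual ψ, ⟨⟨⟨fun x => ?_, fun x y => ?_⟩, ?_⟩, τs, hτs, hlim⟩, hlim⟩
  · obtain ⟨a, rfl⟩ := ofSeq_surjective x
    exact ge_of_tendsto (hlim (star a * a)) (Eventually.of_forall fun n => (hτs n).1.1 (a n))
  · obtain ⟨a, rfl⟩ := ofSeq_surjective x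
    obtain ⟨b, rfl⟩ := ofSeq_surjective y
    refine tendsto_nhds_unique (hlim (a * b)) ((hlim (b * a)).congr fun n => ?_)
    exact (hτs n).1.2 (b n) (a n)
  · change ‖ψ‖ = 1
    refine le_antisymm (hψn.trans (Λ₀.mkContinuous_norm_le zero_le_one hΛb)) ?_
    refine le_of_forall_pos_le_add fun ε hε => ?_
    obtain ⟨e, -, he1, he⟩ := exists_contraction_forall_trace_gt hc hε
    have h1 : 1 - ε ≤ (ψ (diag ω e)).re :=
      ge_of_tendsto ((Complex.continuous_re.tendsto _).comp (hlim (constSeq e)))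
        (Eventually.of_forall fun n => (he _ (hτs n)).le)
    have h2 : ‖ψ (diag ω e)‖ ≤ ‖ψ‖ :=
      ψ.le_of_opNorm_le_of_le le_rfl ((norm_diag_le e).trans he1) |>.trans_eq (mul_one _)
    linarith [Complex.re_le_norm (ψ (diag ω e))]

lemma limitTraces.apply_eq_zero {τ : WeakDual ℂ (Ultrapower ω A)} (hτ : τ ∈ limitTraces ω A)
    {x : Ultrapower ω A} (hx : x ∈ (traceKernel ω A).toSubmodule) : τ x = 0 := by
  have hz := (boundedTrace_null_iff hτ.1.1 x).1 (hx τ hτ)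
  refine norm_eq_zero.1 (le_antisymm (le_of_forall_pos_le_add fun ε hε => ?_) (norm_nonneg _))
  obtain ⟨e, -, -, -, he⟩ := (traceKernel ω A).exists_approx_unit hx hε
  have h1 : τ x = τ (x - x * e) := by rw [map_sub, hτ.1.1.2 x e, hz, sub_zero]
  rw [h1, zero_add]
  exact (tracialStates.norm_apply_le hτ.1 _).trans he.le

/-- Every limit trace descends to the uniform tracial ultrapower. -/
lemma exists_tracialLimitTrace {τ : WeakDual ℂ (Ultrapower ω A)} (hτ : τ ∈ limitTraces ω A) :
    ∃ σ ∈ tracialLimitTraces ω A, ∀ x, σ ((traceKernel ω A).proj x) = τ x := by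
  obtain ⟨σ, hσ, h⟩ := (traceKernel ω A).exists_tracialState_descend hτ.1
    fun x hx => limitTraces.apply_eq_zero hτ hx
  exact ⟨σ, ⟨hσ, τ, hτ, h⟩, h⟩

/-- A sequence represents an element of the trace kernel ideal if and only if it tends to `0`
along `ω` in the uniform tracial seminorm. -/
lemma ofSeq_mem_traceKernel_iff (hne : (tracialStates A).Nonempty)
    (hc : IsCompact (tracialStates A)) (z : BddSeq A) :
    ofSeq ω z ∈ (traceKernel ω A).toSubmodule ↔ ∀ ε > 0, ∀ᶠ k in (ω : Filter ℕ),
      ∀ τ ∈ tracialStates A, (τ (star (z k) * z k)).re < ε := by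
  constructor
  · intro hz ε hε
    by_contra hcon
    rw [← Ultrafilter.eventually_not] at hcon
    obtain ⟨τ₀, hτ₀⟩ := hne
    have hch : ∀ k, ∃ τ ∈ tracialStates A,
        (¬ ∀ τ ∈ tracialStates A, (τ (star (z k) * z k)).re < ε) →
          ε ≤ (τ (star (z k) * z k)).re := by
      intro k
      by_cases hk : ∀ τ ∈ tracialStates A, (τ (star (z k) * z k)).re < ε
      · exact ⟨τ₀, hτ₀, fun h => absurd hk h⟩
      · push Not at hk
        obtain ⟨τ, hτ, h⟩ := hk
        exact ⟨τ, hτ, fun _ => h⟩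
    choose τs hτs hge using hch
    obtain ⟨τ, hτ, hlim⟩ := exists_limitTrace (ω := ω) hc hτs
    have h1 : ε ≤ (τ (ofSeq ω (star z * z))).re := by
      refine ge_of_tendsto ((Complex.continuous_re.tendsto _).comp (hlim (star z * z))) ?_
      filter_upwards [hcon] with k hk using hge k hk
    have h2 : τ (ofSeq ω (star z * z)) = 0 := hz τ hτ
    rw [h2, Complex.zero_re] at h1
    linarith
  · rintro h τ hτ
    let _ := CStarAlgebra.spectralOrder (Ultrapower ω A)
    have := CStarAlgebra.spectralOrderedRing (Ultrapower ω A)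
    rw [← boundedTraces.ofReal_re hτ.1.1 (star_mul_self_nonneg _), Complex.ofReal_eq_zero]
    refine le_antisymm (le_of_forall_pos_le_add fun ε hε => ?_)
      (boundedTraces.re_nonneg hτ.1.1 (star_mul_self_nonneg _))
    rw [zero_add]
    obtain ⟨-, τs, hτs, hlim⟩ := hτ
    refine le_of_tendsto ((Complex.continuous_re.tendsto _).comp (hlim (star z * z))) ?_
    filter_upwards [h ε hε] with k hk using (hk _ (hτs k)).le

end LimitTraces

/-! ### Bounded traces as extended traces -/

section ExtendedTraces

open scoped ComplexOrder

variable {A : Type*} [NonUnitalCStarAlgebra A] [PartialOrder A] [StarOrderedRing A]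

/-- The extended trace given by a bounded trace. -/
def ExtTrace.ofBounded {φ : WeakDual ℂ A} (hφ : φ ∈ boundedTraces A) : ExtTrace A where
  toFun a := ENNReal.ofReal (φ a.1).re
  map_zero' := by simp
  map_comb' c d _ _ a b := by
    have ha := boundedTraces.re_nonneg hφ a.2
    have hb := boundedTraces.re_nonneg hφ b.2
    have h1 : (φ ((c : ℝ) • a.1 + (d : ℝ) • b.1)).re = c * (φ a.1).re + d * (φ b.1).re := by
      rw [map_add, ← Complex.coe_smul, ← Complex.coe_smul (d : ℝ), map_smul, map_smul,
        smul_eq_mul, smul_eq_mul, Complex.add_re, Complex.re_ofReal_mul, Complex.re_ofReal_mul]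
    simp only [h1]
    rw [ENNReal.ofReal_add (mul_nonneg c.coe_nonneg ha) (mul_nonneg d.coe_nonneg hb),
      ENNReal.ofReal_mul c.coe_nonneg, ENNReal.ofReal_mul d.coe_nonneg,
      ENNReal.ofReal_coe_nnreal, ENNReal.ofReal_coe_nnreal]
  map_star_mul' a := by
    simp only [hφ.2 (star a) a]

lemma ExtTrace.ofBounded_apply {φ : WeakDual ℂ A} (hφ : φ ∈ boundedTraces A) (a : PosCone A) :
    ExtTrace.ofBounded hφ a = ENNReal.ofReal (φ a.1).re := rfl

lemma ExtTrace.ofBounded_isLsc {φ : WeakDual ℂ A} (hφ : φ ∈ boundedTraces A) :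
    (ExtTrace.ofBounded hφ).IsLsc := by
  refine Continuous.lowerSemicontinuous ?_
  exact ENNReal.continuous_ofReal.comp
    (Complex.continuous_re.comp ((map_continuous φ).comp continuous_subtype_val))

lemma cutDown_le {a : A} (ha : 0 ≤ a) {ε : ℝ} (hε : 0 ≤ ε) : (cutDown a ε).1 ≤ a := by
  conv_rhs => rw [← cfcₙ_id' ℝ a]
  refine cfcₙ_mono fun t ht => ?_
  have := quasispectrum_nonneg_of_nonneg a ha t ht
  exact max_le (by linarith) this

lemma norm_sub_cutDown_le {a : A} (ha : 0 ≤ a) {ε : ℝ} (hε : 0 ≤ ε) :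
    ‖a - (cutDown a ε).1‖ ≤ ε := by
  have h1 : a - (cutDown a ε).1 = cfcₙ (fun t : ℝ => t - max (t - ε) 0) a := by
    rw [cfcₙ_sub (fun t : ℝ => t) (fun t => max (t - ε) 0) a, cfcₙ_id' ℝ a]
    rfl
  rw [h1]
  refine norm_cfcₙ_le fun t ht => ?_
  have := quasispectrum_nonneg_of_nonneg a ha t ht
  rw [Real.norm_eq_abs, abs_le]
  rcases le_total (t - ε) 0 with h | h
  · rw [max_eq_right h]; constructor <;> linarith
  · rw [max_eq_left h]; constructor <;> linarith

lemma norm_cutDown_le {a : A} (ha : 0 ≤ a) {ε : ℝ} (hε : 0 ≤ ε) : ‖(cutDown a ε).1‖ ≤ ‖a‖ :=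
  CStarAlgebra.norm_le_norm_of_nonneg_of_le (cutDown a ε).2 (cutDown_le ha hε)

variable {ω : Ultrafilter ℕ}

/-- The formula for a generalised limit trace, when the traces `tₙ` are (along `ω`) multiples
`cₙ σₙ` of tracial states with `cₙ` convergent: cutting down by `ε` is then harmless. -/
lemma iSup_limUnder_cutDown {σs : ℕ → WeakDual ℂ A} (hσs : ∀ n, σs n ∈ tracialStates A)
    {σ : WeakDual ℂ (Ultrapower ω A)}
    (hσ : ∀ a : BddSeq A, Tendsto (fun n => σs n (a n)) ω (𝓝 (σ (ofSeq ω a))))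
    {c : ℕ → ℝ} {c₀ : ℝ} (hc0 : ∀ n, 0 ≤ c n) (hc : Tendsto c ω (𝓝 c₀)) {t : ℕ → ExtTrace A}
    (ht : ∀ᶠ n in (ω : Filter ℕ), ∀ x : PosCone A, t n x = ENNReal.ofReal (c n * (σs n x.1).re))
    (a : BddSeq A) (ha : ∀ n, 0 ≤ a n) :
    ⨆ (ε : ℝ) (_ : 0 < ε), limUnder (ω : Filter ℕ) (fun n => t n (cutDown (a n) ε)) =
      ENNReal.ofReal (c₀ * (σ (ofSeq ω a)).re) := by
  have hc₀ : 0 ≤ c₀ := ge_of_tendsto hc (Eventually.of_forall hc0)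
  have hre : ∀ b : BddSeq A, Tendsto (fun n => (σs n (b n)).re) ω (𝓝 (σ (ofSeq ω b)).re) :=
    fun b => (Complex.continuous_re.tendsto _).comp (hσ b)
  let b : ∀ ε : ℝ, 0 < ε → BddSeq A := fun ε hε =>
    mkSeq (fun n => (cutDown (a n) ε).1) ‖a‖ fun n =>
      (norm_cutDown_le (ha n) hε.le).trans (norm_seq_apply_le a n)
  have hlim : ∀ (ε : ℝ) (hε : 0 < ε),
      limUnder (ω : Filter ℕ) (fun n => t n (cutDown (a n) ε)) =
        ENNReal.ofReal (c₀ * (σ (ofSeq ω (b ε hε))).re) := by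
    intro ε hε
    refine Tendsto.limUnder_eq ?_
    refine ((ENNReal.continuous_ofReal.tendsto _).comp (hc.mul (hre (b ε hε)))).congr' ?_
    filter_upwards [ht] with n hn
    rw [hn]; rfl
  refine le_antisymm (iSup₂_le fun ε hε => ?_) ?_
  · rw [hlim ε hε]
    refine ENNReal.ofReal_le_ofReal (mul_le_mul_of_nonneg_left ?_ hc₀)
    exact le_of_tendsto_of_tendsto' (hre (b ε hε)) (hre a) fun n =>
      boundedTraces.re_mono (hσs n).1 (cutDown_le (ha n) hε.le)
  · have h1 : Tendsto (fun ε : ℝ => ENNReal.ofReal (c₀ * ((σ (ofSeq ω a)).re - ε))) (𝓝[>] 0)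
        (𝓝 (ENNReal.ofReal (c₀ * ((σ (ofSeq ω a)).re - 0)))) := by
      have : Continuous fun ε : ℝ => ENNReal.ofReal (c₀ * ((σ (ofSeq ω a)).re - ε)) :=
        ENNReal.continuous_ofReal.comp (by fun_prop)
      exact (this.tendsto 0).mono_left nhdsWithin_le_nhds
    rw [sub_zero] at h1
    refine le_of_tendsto h1 ?_
    filter_upwards [self_mem_nhdsWithin] with ε hε
    refine le_trans ?_ (le_iSup₂ (f := fun (ε : ℝ) (_ : 0 < ε) =>
      limUnder (ω : Filter ℕ) fun n => t n (cutDown (a n) ε)) ε hε)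
    rw [hlim ε hε]
    refine ENNReal.ofReal_le_ofReal (mul_le_mul_of_nonneg_left ?_ hc₀)
    rw [sub_le_iff_le_add]
    refine le_of_tendsto_of_tendsto' (hre a) ((hre (b ε hε)).add_const ε) fun n => ?_
    have h2 := (tracialStates.re_apply_le (hσs n) (a n - (cutDown (a n) ε).1)).trans
      (norm_sub_cutDown_le (ha n) (le_of_lt hε))
    rw [map_sub, Complex.sub_re] at h2
    change _ ≤ (σs n (cutDown (a n) ε).1).re + ε
    linarith

lemma limitTraces.ofBounded_mem {τ : WeakDual ℂ (Ultrapower ω A)} (hτ : τ ∈ limitTraces ω A) :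
    ExtTrace.ofBounded hτ.1.1 ∈ genLimitTraces ω A := by
  obtain ⟨hτ1, τs, hτs, hlim⟩ := hτ
  refine ⟨fun n => ExtTrace.ofBounded (hτs n).1, fun n => ExtTrace.ofBounded_isLsc _,
    fun a ha => ?_⟩
  rw [iSup_limUnder_cutDown hτs hlim (fun _ => zero_le_one) tendsto_const_nhds
    (Eventually.of_forall fun n x => by rw [one_mul]; rfl) a ha, one_mul]
  rfl

end ExtendedTraces

/-! ### From stabilised to uniform property Γ -/

section StabilisedToUniform

open scoped ComplexOrder

variable {ω : Ultrafilter ℕ} {A : Type*} [NonUnitalCStarAlgebra A]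

lemma limitTraces.exists_diag_gt [PartialOrder A] [StarOrderedRing A]
    (hc : IsCompact (tracialStates A)) {ε : ℝ} (hε : 0 < ε) :
    ∃ e : A, 0 ≤ e ∧ ‖e‖ ≤ 1 ∧ ∀ τ ∈ limitTraces ω A, 1 - ε ≤ (τ (diag ω e)).re := by
  obtain ⟨e, he0, he1, he⟩ := exists_contraction_forall_trace_gt hc hε
  refine ⟨e, he0, he1, fun τ hτ => ?_⟩
  obtain ⟨-, τs, hτs, hlim⟩ := hτ
  exact ge_of_tendsto ((Complex.continuous_re.tendsto _).comp (hlim (constSeq e)))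
    (Eventually.of_forall fun n => (he _ (hτs n)).le)

lemma one_sub_diag_nonneg [PartialOrder A] [StarOrderedRing A] {e : A} (he0 : 0 ≤ e)
    (he1 : ‖e‖ ≤ 1) : 0 ≤ 1 - (diag ω e : Unitization ℂ (Ultrapower ω A)) := by
  rw [sub_nonneg, ← CStarAlgebra.norm_le_one_iff_of_nonneg _
    (Unitization.inr_nonneg_iff.2 (diag_nonneg ω he0)), Unitization.norm_inr]
  exact (norm_diag_le e).trans he1

/-- If `T(A)` is compact, the annihilator of `A` in `A_ω ∩ A'` lies in the trace kernel ideal: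
the limit traces are almost `1` at a contraction of `A`. -/
lemma annIdeal_subset_traceKernel (hc : IsCompact (tracialStates A)) {x : relComm ω A}
    (hx : x ∈ (annIdeal ω A).toSubmodule) : x.1 ∈ (traceKernel ω A).toSubmodule := by
  let _ := CStarAlgebra.spectralOrder A
  have := CStarAlgebra.spectralOrderedRing A
  intro τ hτ
  rw [← boundedTraces.ofReal_re hτ.1.1 (star_mul_self_nonneg _), Complex.ofReal_eq_zero]
  refine le_antisymm (le_of_forall_pos_le_add fun ε hε => ?_)
    (boundedTraces.re_nonneg hτ.1.1 (star_mul_self_nonneg _))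
  obtain ⟨e, he0, he1, he⟩ := limitTraces.exists_diag_gt (ω := ω) hc
    (show 0 < ε / (‖x.1‖ ^ 2 + 1) by positivity)
  have h1 := unitizeTrace_conj_le hτ.1 (one_sub_diag_nonneg (ω := ω) he0 he1)
    (x.1 : Unitization ℂ (Ultrapower ω A))
  have h2 : star (x.1 : Unitization ℂ (Ultrapower ω A)) * (1 - (diag ω e : Unitization ℂ _)) *
      (x.1 : Unitization ℂ (Ultrapower ω A)) =
      ((star x.1 * x.1 : Ultrapower ω A) : Unitization ℂ (Ultrapower ω A)) := by
    rw [mul_assoc, sub_mul, one_mul, ← Unitization.inr_mul, (hx e).2, Unitization.inr_zero,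
      sub_zero, Unitization.inr_mul, Unitization.inr_star]
  rw [h2, unitizeTrace_inr, map_sub, unitizeTrace_one, unitizeTrace_inr, Complex.sub_re,
    Complex.one_re, Unitization.norm_inr] at h1
  have h3 := he τ hτ
  have h4 : ‖x.1‖ ^ 2 * (1 - (τ (diag ω e)).re) ≤ ‖x.1‖ ^ 2 * (ε / (‖x.1‖ ^ 2 + 1)) := by
    gcongr; linarith
  have h5 : ‖x.1‖ ^ 2 * (ε / (‖x.1‖ ^ 2 + 1)) ≤ ε := by
    rw [mul_div_assoc', div_le_iff₀ (by positivity)]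
    nlinarith [sq_nonneg ‖x.1‖]
  linarith

/-- A self-adjoint `s` with `τ((1 - s)²) = 0` for all limit traces `τ` acts as a left unit modulo
the trace kernel ideal. -/
lemma mul_sub_mem_traceKernel {s : Ultrapower ω A} (hs : IsSelfAdjoint s)
    (h : ∀ τ ∈ limitTraces ω A, 1 - 2 * (τ s).re + (τ (s * s)).re ≤ 0) (y : Ultrapower ω A) :
    s * y - y ∈ (traceKernel ω A).toSubmodule := by
  intro τ hτ
  let _ := CStarAlgebra.spectralOrder A
  have := CStarAlgebra.spectralOrderedRing A
  rw [← boundedTraces.ofReal_re hτ.1.1 (star_mul_self_nonneg _), Complex.ofReal_eq_zero]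
  refine le_antisymm ?_ (boundedTraces.re_nonneg hτ.1.1 (star_mul_self_nonneg _))
  let r : Unitization ℂ (Ultrapower ω A) := 1 - s
  have hr : star r = r := by
    simp only [r, star_sub, star_one, ← Unitization.inr_star, hs.star_eq]
  have hm : 0 ≤ r * r := by
    nth_rw 1 [← hr]; exact star_mul_self_nonneg r
  have h1 := unitizeTrace_conj_le hτ.1 hm (y : Unitization ℂ (Ultrapower ω A))
  have h2 : star (y : Unitization ℂ (Ultrapower ω A)) * (r * r) *
      (y : Unitization ℂ (Ultrapower ω A)) =
      ((star (s * y - y) * (s * y - y) : Ultrapower ω A) : Unitization ℂ (Ultrapower ω A)) := by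
    simp only [r, star_sub, star_mul, hs.star_eq, Unitization.inr_mul, Unitization.inr_sub,
      Unitization.inr_star]
    noncomm_ring
  have h3 : r * r = 1 - (2 : ℂ) • (s : Unitization ℂ (Ultrapower ω A)) +
      ((s * s : Ultrapower ω A) : Unitization ℂ _) := by
    simp only [r, Unitization.inr_mul, two_smul]
    noncomm_ring
  rw [h2, h3, unitizeTrace_inr, map_add, map_sub, map_smul, unitizeTrace_one, unitizeTrace_inr,
    unitizeTrace_inr] at h1
  have h4 := h τ hτ
  simp only [smul_eq_mul, Complex.add_re, Complex.sub_re, Complex.one_re, Complex.mul_re,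
    Complex.re_ofNat, Complex.im_ofNat, zero_mul, sub_zero] at h1
  exact h1.trans (mul_nonpos_of_nonneg_of_nonpos (by positivity) h4)

variable [PartialOrder A] [StarOrderedRing A]

/-- An identity `τ(a x) = λ τ(a)` for all `a ∈ A` determines `τ(x) = λ`, because the limit traces
are almost `1` at a positive contraction of `A`. -/
lemma limitTraces.re_apply_of_forall_diag (hc : IsCompact (tracialStates A))
    {τ : WeakDual ℂ (Ultrapower ω A)} (hτ : τ ∈ limitTraces ω A) {c : Ultrapower ω A}
    {l : ℝ} (hl : 0 ≤ l)
    (h : ∀ a : A, 0 ≤ a → (τ (diag ω a * (star c * c))).re = l * (τ (diag ω a)).re) :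
    (τ (star c * c)).re = l := by
  have hlim1 : Tendsto (fun ε : ℝ => l + ε * ‖c‖ ^ 2) (𝓝[>] 0) (𝓝 (l + 0 * ‖c‖ ^ 2)) :=
    ((by fun_prop : Continuous fun ε : ℝ => l + ε * ‖c‖ ^ 2).tendsto 0).mono_left
      nhdsWithin_le_nhds
  have hlim2 : Tendsto (fun ε : ℝ => l * (1 - ε)) (𝓝[>] 0) (𝓝 (l * (1 - 0))) :=
    ((by fun_prop : Continuous fun ε : ℝ => l * (1 - ε)).tendsto 0).mono_left nhdsWithin_le_nhds
  have key : ∀ ε : ℝ, 0 < ε → (τ (star c * c)).re ≤ l + ε * ‖c‖ ^ 2 ∧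
      l * (1 - ε) ≤ (τ (star c * c)).re := by
    intro ε hε
    obtain ⟨e, he0, he1, he⟩ := limitTraces.exists_diag_gt (ω := ω) hc hε
    have hpos := one_sub_diag_nonneg (ω := ω) he0 he1
    have h1 := unitizeTrace_conj_le hτ.1 hpos (star (c : Unitization ℂ (Ultrapower ω A)))
    have h0 := unitizeTrace_re_nonneg hτ.1 (star_left_conjugate_nonneg hpos
      (star (c : Unitization ℂ (Ultrapower ω A))))
    have h2 : unitizeTrace τ (star (star (c : Unitization ℂ (Ultrapower ω A))) *
        (1 - (diag ω e : Unitization ℂ _)) * star (c : Unitization ℂ (Ultrapower ω A))) =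
        τ (star c * c) - τ (diag ω e * (star c * c)) := by
      rw [star_star, mul_assoc, unitizeTrace_comm hτ.1.1, ← map_sub, ← unitizeTrace_inr τ]
      congr 1
      simp only [Unitization.inr_sub, Unitization.inr_mul, Unitization.inr_star]
      noncomm_ring
    rw [h2, Complex.sub_re, h e he0] at h0 h1
    rw [map_sub, unitizeTrace_one, unitizeTrace_inr, Complex.sub_re, Complex.one_re, norm_star,
      Unitization.norm_inr] at h1
    have h3 := he τ hτ
    have h4 : (τ (diag ω e)).re ≤ 1 :=
      (tracialStates.re_apply_le hτ.1 _).trans ((norm_diag_le e).trans he1)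
    have h5 : ‖c‖ ^ 2 * (1 - (τ (diag ω e)).re) ≤ ‖c‖ ^ 2 * ε := by gcongr; linarith
    constructor <;> nlinarith
  refine le_antisymm ?_ ?_
  · rw [zero_mul, add_zero] at hlim1
    refine ge_of_tendsto hlim1 ?_
    filter_upwards [self_mem_nhdsWithin] with ε hε using (key ε hε).1
  · rw [sub_zero, mul_one] at hlim2
    refine le_of_tendsto hlim2 ?_
    filter_upwards [self_mem_nhdsWithin] with ε hε using (key ε hε).2

/-- Stabilised property Γ implies uniform property Γ if `T(A)` is compact. -/
theorem HasStabilisedGamma.hasUniformGamma (hc : IsCompact (tracialStates A))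
    (h : HasStabilisedGamma ω A) : HasUniformGamma ω A := by
  intro n hn
  obtain ⟨e, he1, heo, heτ⟩ := h n hn
  choose c hc1 hce using fun i => (annIdeal ω A).exists_positive_lift (e i).2 (he1 i)
  let x : Fin n → relComm ω A := fun i => star (c i) * c i
  let J := traceKernel ω A
  let p : Fin n → TracialUltrapower ω A := fun i => J.proj (x i).1
  have hn' : (0 : ℝ) < n := by exact_mod_cast hn
  have hx0 : ∀ i, 0 ≤ (x i).1 := fun i => star_mul_self_nonneg (c i).1
  have hx1 : ∀ i, ‖(x i).1‖ ≤ 1 := fun i => by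
    change ‖star (c i).1 * (c i).1‖ ≤ 1
    rw [CStarRing.norm_star_mul_self]
    exact mul_le_one₀ (hc1 i) (norm_nonneg _) (hc1 i)
  have hxs : ∀ i, IsSelfAdjoint (x i).1 := fun i => .of_nonneg (hx0 i)
  have hpos : ∀ τ ∈ limitTraces ω A, ∀ a : A, 0 ≤ a → ∀ i,
      0 ≤ diag ω a * (x i).1 ∧
      (τ (diag ω a * (x i).1)).re = (1 / n : ℝ) * (τ (diag ω a)).re := by
    intro τ hτ a ha i
    have h1 := heτ ⟨a, ha⟩ _ (limitTraces.ofBounded_mem hτ) ENNReal.ofReal_lt_top i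
    have h2 : leftMul ω a (e i).1 = diag ω a * (x i).1 := by
      rw [← hce i, leftMul_proj]
    have h3 : 0 ≤ diag ω a * (x i).1 := h2 ▸ leftMul_nonneg ω ha (e i).2
    refine ⟨h3, ?_⟩
    simp only [inducedTrace, ExtTrace.ofBounded_apply, h2] at h1
    have h4 : (1 / n : ℝ≥0∞) = ENNReal.ofReal (1 / n) := by
      rw [ENNReal.ofReal_div_of_pos hn', ENNReal.ofReal_one, ENNReal.ofReal_natCast]
    have h5 := boundedTraces.re_nonneg hτ.1.1 (diag_nonneg ω ha)
    rw [h4, ← ENNReal.ofReal_mul (by positivity), ENNReal.ofReal_eq_ofReal_iff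
      (boundedTraces.re_nonneg hτ.1.1 h3) (by positivity)] at h1
    exact h1
  have htr : ∀ τ ∈ limitTraces ω A, ∀ a : A, ∀ i,
      τ (diag ω a * (x i).1) = (1 / n : ℂ) * τ (diag ω a) := by
    intro τ hτ a i
    have ha : a ∈ Submodule.span ℂ {a : A | 0 ≤ a} := by
      rw [CStarAlgebra.span_nonneg]; exact Submodule.mem_top
    induction ha using Submodule.span_induction with
    | mem a ha =>
      obtain ⟨h1, h2⟩ := hpos τ hτ a ha i
      rw [← boundedTraces.ofReal_re hτ.1.1 h1, h2,
        ← boundedTraces.ofReal_re hτ.1.1 (diag_nonneg ω ha)]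
      push_cast
      rfl
    | zero =>
      have : diag ω (0 : A) = 0 := map_zero (nullIdeal ω A).proj
      simp [this]
    | add a b _ _ iha ihb =>
      have : diag ω (a + b) = diag ω a + diag ω b := ofSeq_add (constSeq a) (constSeq b)
      rw [this, add_mul, map_add, map_add, iha, ihb, mul_add]
    | smul z a _ iha =>
      have : diag ω (z • a) = z • diag ω a := ofSeq_smul z (constSeq a)
      rw [this, smul_mul_assoc, map_smul, map_smul, iha, smul_eq_mul, smul_eq_mul]
      ring
  have hone : ∀ τ ∈ limitTraces ω A, ∀ i, (τ (x i).1).re = 1 / n := fun τ hτ i =>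
    limitTraces.re_apply_of_forall_diag (c := (c i).1) hc hτ (by positivity)
      fun a ha => (hpos τ hτ a ha i).2
  have hort : ∀ i j, i ≠ j → (x i).1 * (x j).1 ∈ J.toSubmodule := by
    intro i j hij
    refine annIdeal_subset_traceKernel (x := x i * x j) hc ?_
    rw [← ClosedIdeal.proj_eq_zero, ClosedIdeal.proj_mul, hce, hce, heo i j hij]
  let s : Ultrapower ω A := ∑ i, (x i).1
  have hss : IsSelfAdjoint s := isSelfAdjoint_sum _ fun i _ => hxs i
  have hsτ : ∀ τ ∈ limitTraces ω A, 1 - 2 * (τ s).re + (τ (s * s)).re ≤ 0 := by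
    intro τ hτ
    have hs1 : (τ s).re = 1 := by
      simp only [s, map_sum, Complex.re_sum, hone τ hτ]
      simp [hn'.ne']
    have hs2 : (τ (s * s)).re ≤ 1 := by
      have h1 : τ (s * s) = ∑ i, τ ((x i).1 * (x i).1) := by
        simp only [s, Finset.sum_mul_sum, map_sum]
        refine Finset.sum_congr rfl fun i _ => ?_
        exact Finset.sum_eq_single i
          (fun j _ hj => limitTraces.apply_eq_zero hτ (hort i j hj.symm)) (by simp)
      rw [h1, Complex.re_sum]
      calc ∑ i, (τ ((x i).1 * (x i).1)).re ≤ ∑ i : Fin n, (1 / n : ℝ) :=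
            Finset.sum_le_sum fun i _ => by
              rw [← hone τ hτ i]
              exact boundedTraces.re_mono hτ.1.1 (mul_self_le_self (hx0 i) (hx1 i))
        _ = 1 := by simp [hn'.ne']
    linarith
  have hsum : ∑ i, p i = J.proj s := (map_sum J.proj _ _).symm
  have hunit : ∀ y : TracialUltrapower ω A, (∑ i, p i) * y = y ∧ y * (∑ i, p i) = y := by
    intro q
    obtain ⟨y, rfl⟩ := J.proj_surjective q
    rw [hsum]
    constructor
    · rw [← ClosedIdeal.proj_mul, ClosedIdeal.proj_eq_proj]
      exact mul_sub_mem_traceKernel hss hsτ y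
    · rw [← ClosedIdeal.proj_mul, ClosedIdeal.proj_eq_proj]
      have := J.star_mem' (mul_sub_mem_traceKernel hss hsτ (star y))
      rw [star_sub, star_mul, star_star, hss.star_eq] at this
      exact this
  refine ⟨p, fun i => ⟨?_, ?_⟩, fun i a => ?_, hunit, fun a σ hσ i => ?_⟩
  · -- `pᵢ = (∑ⱼ pⱼ) pᵢ = pᵢ²` by orthogonality
    have h1 := (hunit (p i)).1
    rw [Finset.sum_mul, Finset.sum_eq_single i] at h1
    · exact h1
    · intro j _ hj
      change J.proj _ * J.proj _ = 0
      rw [← ClosedIdeal.proj_mul, ClosedIdeal.proj_eq_zero]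
      exact hort j i hj
    · simp
  · change star (J.proj _) = J.proj _
    rw [← ClosedIdeal.proj_star, (hxs i).star_eq]
  · change J.proj _ * J.proj _ = J.proj _ * J.proj _
    rw [← ClosedIdeal.proj_mul, ← ClosedIdeal.proj_mul, (mem_relComm ω).1 (x i).2 a]
  · obtain ⟨-, τ, hτ, hστ⟩ := hσ
    change σ (J.proj (diag ω a) * J.proj (x i).1) = _ * σ (J.proj (diag ω a))
    rw [← ClosedIdeal.proj_mul, hστ, hστ, htr τ hτ]

end StabilisedToUniform

/-! ### The domain of an extended trace -/

section Polarization

variable {A : Type*} [NonUnitalCStarAlgebra A]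

lemma four_smul_star_mul (u v : A) :
    (4 : ℂ) • (star v * u) = star (u + v) * (u + v) - star (u - v) * (u - v) +
      Complex.I • (star (u + Complex.I • v) * (u + Complex.I • v)) -
      Complex.I • (star (u - Complex.I • v) * (u - Complex.I • v)) := by
  have h1 : star (Complex.I • v) = -(Complex.I • star v) := by
    rw [star_smul, ← neg_smul]; simp
  simp only [star_add, star_sub, h1, add_mul, sub_mul, mul_add, mul_sub, smul_add, smul_sub,
    smul_mul_assoc, mul_smul_comm, neg_mul, smul_neg, mul_neg, smul_smul, Complex.I_mul_I]
  module

lemma four_smul_mul_star (u v : A) :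
    (4 : ℂ) • (u * star v) = (u + v) * star (u + v) - (u - v) * star (u - v) +
      Complex.I • ((u + Complex.I • v) * star (u + Complex.I • v)) -
      Complex.I • ((u - Complex.I • v) * star (u - Complex.I • v)) := by
  have h1 : star (Complex.I • v) = -(Complex.I • star v) := by
    rw [star_smul, ← neg_smul]; simp
  simp only [star_add, star_sub, h1, add_mul, sub_mul, mul_add, mul_sub, smul_add, smul_sub,
    smul_mul_assoc, mul_smul_comm, smul_neg, mul_neg, smul_smul, Complex.I_mul_I]
  module

end Polarization

namespace ExtTrace

variable {A : Type*} [NonUnitalCStarAlgebra A] [PartialOrder A] [StarOrderedRing A]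
  (τ : ExtTrace A)

lemma apply_add {a b : A} (ha : 0 ≤ a) (hb : 0 ≤ b) :
    τ ⟨a + b, add_nonneg ha hb⟩ = τ ⟨a, ha⟩ + τ ⟨b, hb⟩ := by
  have := τ.map_comb' 1 1 one_pos one_pos ⟨a, ha⟩ ⟨b, hb⟩
  simpa using this

lemma apply_smul {a : A} (ha : 0 ≤ a) {c : ℝ} (hc : 0 ≤ c) :
    τ ⟨c • a, smul_nonneg hc ha⟩ = ENNReal.ofReal c * τ ⟨a, ha⟩ := by
  rcases hc.eq_or_lt with rfl | hc
  · simpa using τ.map_zero'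
  · have h := τ.map_comb' c.toNNReal 1 (Real.toNNReal_pos.2 hc) one_pos ⟨a, ha⟩ ⟨0, le_rfl⟩
    rw [τ.map_zero', mul_zero, add_zero] at h
    rw [ENNReal.ofReal, ← h]
    congr 2
    simp [Real.coe_toNNReal c hc.le]

lemma mono {a b : A} (ha : 0 ≤ a) (hab : a ≤ b) : τ ⟨a, ha⟩ ≤ τ ⟨b, ha.trans hab⟩ := by
  have h := τ.apply_add ha (sub_nonneg.2 hab)
  have h2 : τ ⟨a + (b - a), add_nonneg ha (sub_nonneg.2 hab)⟩ = τ ⟨b, ha.trans hab⟩ := by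
    congr 2; abel
  rw [← h2, h]
  exact le_self_add

/-- The positive elements with finite trace. -/
def IsFinite (a : A) : Prop := ∃ h : 0 ≤ a, τ ⟨a, h⟩ < ∞

variable {τ}

lemma IsFinite.add {a b : A} (ha : τ.IsFinite a) (hb : τ.IsFinite b) : τ.IsFinite (a + b) :=
  ⟨add_nonneg ha.1 hb.1, by
    rw [τ.apply_add ha.1 hb.1]; exact ENNReal.add_lt_top.2 ⟨ha.2, hb.2⟩⟩

lemma IsFinite.smul {a : A} (ha : τ.IsFinite a) {c : ℝ} (hc : 0 ≤ c) : τ.IsFinite (c • a) :=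
  ⟨smul_nonneg hc ha.1, by
    rw [τ.apply_smul ha.1 hc]; exact ENNReal.mul_lt_top ENNReal.ofReal_lt_top ha.2⟩

lemma IsFinite.mono {a b : A} (hb : τ.IsFinite b) (ha : 0 ≤ a) (hab : a ≤ b) : τ.IsFinite a :=
  ⟨ha, (τ.mono ha hab).trans_lt hb.2⟩

lemma IsFinite.mul_star {x : A} (h : τ.IsFinite (star x * x)) : τ.IsFinite (x * star x) :=
  ⟨mul_star_self_nonneg x, by rw [← τ.map_star_mul']; exact h.2⟩

lemma IsFinite.star_add_mul_add {u v : A} (hu : τ.IsFinite (star u * u))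
    (hv : τ.IsFinite (star v * v)) : τ.IsFinite (star (u + v) * (u + v)) := by
  refine ((hu.smul zero_le_two).add (hv.smul zero_le_two)).mono (star_mul_self_nonneg _) ?_
  rw [← sub_nonneg]
  have h : (2 : ℝ) • (star u * u) + (2 : ℝ) • (star v * v) - star (u + v) * (u + v) =
      star (u - v) * (u - v) := by
    rw [two_smul, two_smul, star_add, star_sub]
    noncomm_ring
  rw [h]
  exact star_mul_self_nonneg _

lemma IsFinite.star_smul_mul_smul {v : A} (hv : τ.IsFinite (star v * v)) {z : ℂ} (hz : ‖z‖ = 1) :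
    τ.IsFinite (star (z • v) * (z • v)) := by
  have h : star (z • v) * (z • v) = star v * v := by
    rw [star_smul, smul_mul_smul_comm, Complex.star_def, ← Complex.normSq_eq_conj_mul_self,
      Complex.normSq_eq_norm_sq, hz]
    simp
  rwa [h]

lemma IsFinite.mem_dom {a : A} (ha : τ.IsFinite a) : a ∈ τ.dom := Submodule.subset_span ha

lemma star_mul_mem_dom {u v : A} (hu : τ.IsFinite (star u * u))
    (hv : τ.IsFinite (star v * v)) : star v * u ∈ τ.dom := by
  have h4 : (4 : ℂ) • (star v * u) ∈ τ.dom := by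
    rw [four_smul_star_mul]
    have hI : τ.IsFinite (star (Complex.I • v) * (Complex.I • v)) :=
      hv.star_smul_mul_smul Complex.norm_I
    have hneg : ∀ {w : A}, τ.IsFinite (star w * w) → τ.IsFinite (star (-w) * -w) := by
      intro w hw; simpa using hw
    refine sub_mem (add_mem (sub_mem ?_ ?_) (Submodule.smul_mem _ _ ?_))
      (Submodule.smul_mem _ _ ?_)
    · exact (hu.star_add_mul_add hv).mem_dom
    · rw [sub_eq_add_neg]; exact (hu.star_add_mul_add (hneg hv)).mem_dom
    · exact (hu.star_add_mul_add hI).mem_dom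
    · rw [sub_eq_add_neg]; exact (hu.star_add_mul_add (hneg hI)).mem_dom
  have := τ.dom.smul_mem (4 : ℂ)⁻¹ h4
  rwa [smul_smul, inv_mul_cancel₀ (by norm_num), one_smul] at this

lemma IsFinite.sqrt_mul {a : A} (ha : τ.IsFinite a) (x : A) :
    τ.IsFinite (star (CFC.sqrt a * x) * (CFC.sqrt a * x)) := by
  have hs : star (CFC.sqrt a) = CFC.sqrt a :=
    (IsSelfAdjoint.of_nonneg (CFC.sqrt_nonneg a)).star_eq
  have h : τ.IsFinite (star (star x * CFC.sqrt a) * (star x * CFC.sqrt a)) := by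
    refine (ha.smul (norm_nonneg (x * star x))).mono (star_mul_self_nonneg _) ?_
    have h1 := CStarAlgebra.star_left_conjugate_le_norm_smul (a := CFC.sqrt a) (b := x * star x)
      (IsSelfAdjoint.mul_star_self x)
    rw [hs, CFC.sqrt_mul_sqrt_self a ha.1] at h1
    rw [star_mul, star_star, hs]
    simpa only [mul_assoc] using h1
  have h2 := h.mul_star
  have h3 : star x * CFC.sqrt a * star (star x * CFC.sqrt a) =
      star (CFC.sqrt a * x) * (CFC.sqrt a * x) := by
    rw [star_mul, star_mul, star_star, hs]
  rwa [h3] at h2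

lemma IsFinite.star_sqrt_mul_sqrt {a : A} (ha : τ.IsFinite a) :
    τ.IsFinite (star (CFC.sqrt a) * CFC.sqrt a) := by
  rw [(IsSelfAdjoint.of_nonneg (CFC.sqrt_nonneg a)).star_eq, CFC.sqrt_mul_sqrt_self a ha.1]
  exact ha

lemma mul_mem_dom (x : A) {d : A} (hd : d ∈ τ.dom) : x * d ∈ τ.dom := by
  induction hd using Submodule.span_induction with
  | mem a ha =>
    have ha : τ.IsFinite a := ha
    have := star_mul_mem_dom ha.star_sqrt_mul_sqrt (ha.sqrt_mul (star x))
    rwa [star_mul, star_star, (IsSelfAdjoint.of_nonneg (CFC.sqrt_nonneg a)).star_eq, mul_assoc,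
      CFC.sqrt_mul_sqrt_self a ha.1] at this
  | zero => simp
  | add a b _ _ iha ihb => rw [mul_add]; exact add_mem iha ihb
  | smul c a _ iha => rw [mul_smul_comm]; exact Submodule.smul_mem _ c iha

lemma mem_dom_mul (x : A) {d : A} (hd : d ∈ τ.dom) : d * x ∈ τ.dom := by
  induction hd using Submodule.span_induction with
  | mem a ha =>
    have ha : τ.IsFinite a := ha
    have := star_mul_mem_dom (ha.sqrt_mul x) ha.star_sqrt_mul_sqrt
    rwa [(IsSelfAdjoint.of_nonneg (CFC.sqrt_nonneg a)).star_eq, ← mul_assoc,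
      CFC.sqrt_mul_sqrt_self a ha.1] at this
  | zero => simp
  | add a b _ _ iha ihb => rw [add_mul]; exact add_mem iha ihb
  | smul c a _ iha => rw [smul_mul_assoc]; exact Submodule.smul_mem _ c iha

/-- On a simple C*-algebra, an extended trace which is finite at some non-zero positive element is
densely defined: the closure of its domain is an ideal. -/
lemma IsFinite.isDenselyDefined (hsimple : IsSimpleCStar A) {b : A} (hb : τ.IsFinite b)
    (hb0 : b ≠ 0) : τ.IsDenselyDefined := by
  let K := τ.dom.topologicalClosure
  let I : TwoSidedIdeal A := TwoSidedIdeal.mk' (K : Set A) K.zero_mem (fun h1 h2 => K.add_mem h1 h2)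
    (fun h => K.neg_mem h)
    (fun {x y} hy => map_mem_closure (f := fun z => x * z) (by fun_prop) hy
      fun d hd => mul_mem_dom x hd)
    (fun {x y} hx => map_mem_closure (f := fun z => z * y) (by fun_prop) hx
      fun d hd => mem_dom_mul y hd)
  have hI : (I : Set A) = K := TwoSidedIdeal.coe_mk' ..
  rcases hsimple.2 I (by rw [hI]; exact τ.dom.isClosed_topologicalClosure) with h | h
  · have hbI : b ∈ (I : Set A) := by
      rw [hI]; exact τ.dom.le_topologicalClosure hb.mem_dom
    rw [h] at hbI
    exact absurd (by simpa using hbI) hb0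
  · intro x
    have hx : x ∈ (I : Set A) := by rw [h]; trivial
    rw [hI] at hx
    exact hx

end ExtTrace

/-! ### Densely defined traces on unital algebras -/

section UnitalTraces

open scoped ComplexOrder

variable {A : Type*} [NonUnitalCStarAlgebra A] [PartialOrder A] [StarOrderedRing A]

/-- A positively homogeneous additive function on the positive cone extends to a linear
functional. -/
lemma exists_linear_extension (F : A → ℝ) (hadd : ∀ a b, 0 ≤ a → 0 ≤ b → F (a + b) = F a + F b)
    (hsmul : ∀ (c : ℝ) a, 0 ≤ c → 0 ≤ a → F (c • a) = c * F a) :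
    ∃ φ : A →ₗ[ℂ] ℂ, ∀ a, 0 ≤ a → φ a = F a := by
  -- on self-adjoint elements, `g` can be computed from any decomposition `x = p - q`
  let g : A → ℝ := fun x => F x⁺ - F x⁻
  have hg : ∀ {x p q : A}, IsSelfAdjoint x → 0 ≤ p → 0 ≤ q → x = p - q → g x = F p - F q := by
    intro x p q hx hp hq h
    have h1 : x⁺ + q = p + x⁻ := by
      have := CFC.posPart_sub_negPart x hx
      rw [← sub_eq_zero] at this ⊢
      rw [← this, h]; abel
    have h2 := congrArg F h1
    rw [hadd _ _ (CFC.posPart_nonneg x) hq, hadd _ _ hp (CFC.negPart_nonneg x)] at h2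
    simp only [g]
    linarith
  let G : selfAdjoint A →ₗ[ℝ] ℝ :=
    { toFun := fun x => g x
      map_add' := fun x y => by
        have hx := CFC.posPart_sub_negPart x.1 x.2
        have hy := CFC.posPart_sub_negPart y.1 y.2
        rw [hg (x + y).2 (add_nonneg (CFC.posPart_nonneg x.1) (CFC.posPart_nonneg y.1))
          (add_nonneg (CFC.negPart_nonneg x.1) (CFC.negPart_nonneg y.1)) ?_]
        · rw [hadd _ _ (CFC.posPart_nonneg _) (CFC.posPart_nonneg _),
            hadd _ _ (CFC.negPart_nonneg _) (CFC.negPart_nonneg _)]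
          simp only [g]; ring
        · change x.1 + y.1 = _
          nth_rw 1 [← hx, ← hy]
          abel
      map_smul' := fun c x => by
        have hx := CFC.posPart_sub_negPart x.1 x.2
        simp only [RingHom.id_apply, smul_eq_mul]
        rcases le_total 0 c with hc | hc
        · rw [hg (c • x).2 (smul_nonneg hc (CFC.posPart_nonneg x.1))
            (smul_nonneg hc (CFC.negPart_nonneg x.1)) ?_]
          · rw [hsmul _ _ hc (CFC.posPart_nonneg _), hsmul _ _ hc (CFC.negPart_nonneg _)]
            simp only [g]; ring
          · change c • x.1 = _
            nth_rw 1 [← hx]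
            rw [smul_sub]
        · have hc' : 0 ≤ -c := by linarith
          rw [hg (c • x).2 (smul_nonneg hc' (CFC.negPart_nonneg x.1))
            (smul_nonneg hc' (CFC.posPart_nonneg x.1)) ?_]
          · rw [hsmul _ _ hc' (CFC.posPart_nonneg _), hsmul _ _ hc' (CFC.negPart_nonneg _)]
            simp only [g]; ring
          · change c • x.1 = _
            nth_rw 1 [← hx]
            module }
  refine ⟨{ toFun := fun x => G (realPart x) + Complex.I * G (imaginaryPart x)
            map_add' := fun x y => ?_
            map_smul' := fun c x => ?_ }, fun a ha => ?_⟩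
  · simp only [map_add, Complex.ofReal_add]; ring
  · rw [realPart_smul, imaginaryPart_smul, map_sub, map_add]
    simp only [map_smul, smul_eq_mul, RingHom.id_apply]
    apply Complex.ext <;> simp
  · have hs := IsSelfAdjoint.of_nonneg ha
    have h1 : imaginaryPart a = 0 := hs.imaginaryPart
    have h2 : (realPart a : A) = a := hs.coe_realPart
    have h0 : F 0 = 0 := by simpa using hsmul 0 0 le_rfl le_rfl
    have h3 : G (realPart a) = F a := by
      change g (realPart a : A) = F a
      rw [h2, hg hs ha le_rfl (sub_zero a).symm, h0, sub_zero]
    change (G (realPart a) : ℂ) + Complex.I * G (imaginaryPart a) = F a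
    rw [h1, h3, map_zero]
    simp

/-- An extended trace with only finite values is given by a bounded trace. -/
lemma ExtTrace.exists_boundedTrace_of_forall_finite {τ : ExtTrace A}
    (hτ : ∀ a : A, 0 ≤ a → τ.IsFinite a) :
    ∃ φ ∈ boundedTraces A, ∀ a : PosCone A, τ a = ENNReal.ofReal (φ a.1).re := by
  classical
  let F : A → ℝ := fun a => if h : 0 ≤ a then (τ ⟨a, h⟩).toReal else 0
  have hF : ∀ a (h : 0 ≤ a), F a = (τ ⟨a, h⟩).toReal := fun a h => by
    simp only [F, dif_pos h]
  obtain ⟨φ, hφ⟩ := exists_linear_extension F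
    (fun a b ha hb => by
      rw [hF _ (add_nonneg ha hb), hF _ ha, hF _ hb, τ.apply_add ha hb,
        ENNReal.toReal_add (hτ a ha).2.ne (hτ b hb).2.ne])
    (fun c a hc ha => by
      rw [hF _ (smul_nonneg hc ha), hF _ ha, τ.apply_smul ha hc, ENNReal.toReal_mul,
        ENNReal.toReal_ofReal hc])
  have hpos : ∀ a, 0 ≤ a → 0 ≤ φ a := fun a ha => by
    rw [hφ a ha, hF a ha]
    exact_mod_cast ENNReal.toReal_nonneg
  let f : A →ₚ[ℂ] ℂ := PositiveLinearMap.mk₀ φ hpos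
  have hcont : Continuous φ := map_continuous f
  have hsq : ∀ x, φ (star x * x) = φ (x * star x) := fun x => by
    rw [hφ _ (star_mul_self_nonneg x), hφ _ (mul_star_self_nonneg x),
      hF _ (star_mul_self_nonneg x), hF _ (mul_star_self_nonneg x), τ.map_star_mul']
  refine ⟨StrongDual.toWeakDual ⟨φ, hcont⟩, ⟨fun a => hpos _ (star_mul_self_nonneg a),
    fun a b => ?_⟩, fun a => ?_⟩
  · change φ (a * b) = φ (b * a)
    have h1 := congrArg φ (four_smul_star_mul b (star a))
    have h2 := congrArg φ (four_smul_mul_star b (star a))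
    simp only [map_smul, map_sub, map_add, hsq] at h1 h2
    rw [← h2, star_star] at h1
    simpa using h1
  · change τ a = ENNReal.ofReal (φ a.1).re
    rw [hφ a.1 a.2, Complex.ofReal_re, hF a.1 a.2, ENNReal.ofReal_toReal (hτ a.1 a.2).2.ne]

/-- A densely defined trace on a unital C*-algebra is finite. -/
lemma IsUnital.forall_finite (hA : IsUnital A) {τ : ExtTrace A} (hτ : τ.IsDenselyDefined)
    (a : A) (ha : 0 ≤ a) : τ.IsFinite a := by
  obtain ⟨u, hu⟩ := hA
  have hus : star u = u := by
    have h1 : star u * u = star u := (hu (star u)).2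
    have h2 := congrArg star h1
    rw [star_mul, star_star, h1] at h2
    exact h2
  have huu : star u * u = u := by rw [hus, (hu u).1]
  have hu0 : 0 ≤ u := huu ▸ star_mul_self_nonneg u
  have hle : ∀ y : A, IsSelfAdjoint y → y ≤ ‖y‖ • u := fun y hy => by
    have := CStarAlgebra.star_left_conjugate_le_norm_smul (a := u) (b := y) hy
    rwa [huu, hus, (hu y).1, (hu y).2] at this
  -- twice the real part of any element of the domain is dominated by an element of finite trace
  have hdom : ∀ d ∈ τ.dom, ∀ c : ℂ, ∃ b, τ.IsFinite b ∧ c • d + star (c • d) ≤ b := by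
    intro d hd
    induction hd using Submodule.span_induction with
    | mem a ha =>
      have ha : τ.IsFinite a := ha
      refine fun c => ⟨(2 * ‖c‖) • a, ha.smul (by positivity), ?_⟩
      have h1 : c • a + star (c • a) = (2 * c.re) • a := by
        rw [star_smul, (IsSelfAdjoint.of_nonneg ha.1).star_eq, ← add_smul, Complex.star_def,
          Complex.add_conj, Complex.coe_smul]
      rw [h1]
      refine smul_le_smul_of_nonneg_right ?_ ha.1
      linarith [Complex.re_le_norm c]
    | zero => exact fun c => ⟨0, ⟨le_rfl, by rw [τ.map_zero']; simp⟩, by simp⟩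
    | add a b _ _ iha ihb =>
      intro c
      obtain ⟨p, hp, hp'⟩ := iha c
      obtain ⟨q, hq, hq'⟩ := ihb c
      refine ⟨p + q, hp.add hq, ?_⟩
      calc c • (a + b) + star (c • (a + b)) = (c • a + star (c • a)) + (c • b + star (c • b)) := by
            rw [smul_add, star_add]; abel
        _ ≤ p + q := add_le_add hp' hq'
    | smul z a _ iha =>
      intro c
      obtain ⟨p, hp, hp'⟩ := iha (c * z)
      exact ⟨p, hp, by rwa [smul_smul]⟩
  have hufin : τ.IsFinite u := by
    -- an element `d` of the domain close to the unit `u` satisfies `u ≤ d + d*`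
    obtain ⟨d, hd, hdu⟩ := Metric.mem_closure_iff.1 (hτ u) (1 / 2) (by norm_num)
    obtain ⟨b, hb, hdb⟩ := hdom d hd 1
    rw [one_smul] at hdb
    refine hb.mono hu0 (le_trans ?_ hdb)
    have hy : IsSelfAdjoint ((u - d) + star (u - d)) := IsSelfAdjoint.add_star_self _
    have hn : ‖(u - d) + star (u - d)‖ ≤ 1 := by
      refine (norm_add_le _ _).trans ?_
      rw [norm_star, ← dist_eq_norm]
      linarith
    have h1 : (u - d) + star (u - d) ≤ u :=
      (hle _ hy).trans ((smul_le_smul_of_nonneg_right hn hu0).trans_eq (one_smul ℝ u))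
    rw [star_sub, hus, ← sub_nonneg] at h1
    rw [← sub_nonneg]
    calc (0 : A) ≤ _ := h1
      _ = _ := by abel
  exact (hufin.smul (norm_nonneg a)).mono ha (hle a (.of_nonneg ha))

end UnitalTraces

/-! ### Generalised limit traces which are finite at an element of `A` -/

section FiniteGeneralisedLimitTraces

open scoped ComplexOrder

variable {A : Type*} [NonUnitalCStarAlgebra A]

lemma boundedTraces.exists_smul_tracialState (hne : (tracialStates A).Nonempty)
    {φ : WeakDual ℂ A} (hφ : φ ∈ boundedTraces A) :
    ∃ c : ℝ, 0 ≤ c ∧ ∃ σ ∈ tracialStates A, ∀ x, (φ x).re = c * (σ x).re := by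
  set r := ‖WeakDual.toStrongDual φ‖ with hr
  rcases (norm_nonneg (WeakDual.toStrongDual φ)).eq_or_lt with h | h
  · obtain ⟨σ, hσ⟩ := hne
    refine ⟨0, le_rfl, σ, hσ, fun x => ?_⟩
    have h1 := (WeakDual.toStrongDual φ).le_opNorm x
    rw [← h, zero_mul] at h1
    have h2 : φ x = 0 := norm_le_zero_iff.1 h1
    simp [h2]
  · rw [← hr] at h
    refine ⟨r, h.le, ((r⁻¹ : ℝ) : ℂ) • φ, ⟨⟨fun a => ?_, fun a b => ?_⟩, ?_⟩, fun x => ?_⟩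
    · change 0 ≤ ((r⁻¹ : ℝ) : ℂ) * φ (star a * a)
      exact mul_nonneg (by exact_mod_cast (inv_pos.2 h).le) (hφ.1 a)
    · change ((r⁻¹ : ℝ) : ℂ) * φ (a * b) = ((r⁻¹ : ℝ) : ℂ) * φ (b * a)
      rw [hφ.2]
    · change ‖((r⁻¹ : ℝ) : ℂ) • WeakDual.toStrongDual φ‖ = 1
      rw [norm_smul, Complex.norm_real, Real.norm_of_nonneg (inv_pos.2 h).le, ← hr,
        inv_mul_cancel₀ h.ne']
    · change (φ x).re = r * (((r⁻¹ : ℝ) : ℂ) * φ x).re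
      rw [Complex.re_ofReal_mul, mul_inv_cancel_left₀ h.ne']

variable [PartialOrder A] [StarOrderedRing A]

/-- Tracial states on a simple C*-algebra are faithful. -/
lemma tracialStates.re_pos (hsimple : IsSimpleCStar A) {τ : WeakDual ℂ A}
    (hτ : τ ∈ tracialStates A) {b : A} (hb : 0 ≤ b) (hb0 : b ≠ 0) : 0 < (τ b).re := by
  refine (boundedTraces.re_nonneg hτ.1 hb).lt_of_ne' fun h0 => ?_
  obtain ⟨y, rfl⟩ := CStarAlgebra.nonneg_iff_eq_star_mul_self.1 hb
  have hiff := boundedTrace_null_iff hτ.1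
  let K : Set A := {x | τ (star x * x) = 0}
  have hK : ∀ x, x ∈ K ↔ ∀ z, τ (z * x) = 0 := hiff
  let I : TwoSidedIdeal A := TwoSidedIdeal.mk' K (by simp [K])
    (fun {x y} hx hy => by
      rw [hK] at hx hy ⊢
      intro z; rw [mul_add, map_add, hx, hy, add_zero])
    (fun {x} hx => by
      rw [hK] at hx ⊢
      intro z; rw [mul_neg, map_neg, hx, neg_zero])
    (fun {x y} hy => by
      rw [hK] at hy ⊢
      intro z; rw [← mul_assoc, hy])
    (fun {x y} hx => by
      rw [hK] at hx ⊢
      intro z; rw [← mul_assoc, hτ.1.2, ← mul_assoc, hx])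
  have hI : (I : Set A) = K := TwoSidedIdeal.coe_mk' ..
  have hclosed : IsClosed K := isClosed_eq ((map_continuous τ).comp (by fun_prop))
    continuous_const
  have hyK : y ∈ K := by
    change τ (star y * y) = 0
    rw [← boundedTraces.ofReal_re hτ.1 hb, h0, Complex.ofReal_zero]
  rcases hsimple.2 I (by rwa [hI]) with h | h
  · rw [← hI, h] at hyK
    have hy0 : y = 0 := by simpa using hyK
    exact hb0 (by rw [hy0, mul_zero])
  · have hall : ∀ x, τ (star x * x) = 0 := fun x => by
      have hx : x ∈ (I : Set A) := by rw [h]; trivial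
      rwa [hI] at hx
    have hu := CStarAlgebra.increasingApproximateUnit (A := A)
    have h2 : Tendsto (fun f => (τ (f * f)).re) (CStarAlgebra.approximateUnit A) (𝓝 0) := by
      refine tendsto_const_nhds.congr' ?_
      filter_upwards [hu.eventually_star_eq] with f hf
      have := hall f
      rw [hf] at this
      rw [this, Complex.zero_re]
    exact zero_ne_one (tendsto_nhds_unique h2 (tracialStates.tendsto_sq hτ))

lemma exists_forall_le_trace (hsimple : IsSimpleCStar A) (hne : (tracialStates A).Nonempty)
    (hc : IsCompact (tracialStates A)) {b : A} (hb : 0 ≤ b) (hb0 : b ≠ 0) :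
    ∃ m > 0, ∀ τ ∈ tracialStates A, m ≤ (τ b).re := by
  have hcont : Continuous fun τ : WeakDual ℂ A => (τ b).re :=
    Complex.continuous_re.comp (WeakDual.eval_continuous b)
  obtain ⟨τ₀, hτ₀, hmin⟩ := hc.exists_isMinOn hne hcont.continuousOn
  exact ⟨_, tracialStates.re_pos hsimple hτ₀ hb hb0, fun τ hτ => hmin hτ⟩

variable {ω : Ultrafilter ℕ}

/-- Suppose that the densely defined lower semicontinuous traces on the simple C*-algebra `A` are
bounded. Then a generalised limit trace which is finite at a non-zero `a ∈ A₊` is a multiple of a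
limit trace: along `ω`, the defining traces are finite at `(a - ε)₊ ≠ 0`, hence densely defined,
hence multiples `cₙ σₙ` of tracial states, and the `cₙ` are bounded because the tracial states are
bounded below at `(a - ε)₊`. -/
lemma genLimitTraces.exists_eq_smul_limitTrace (hsimple : IsSimpleCStar A)
    (hne : (tracialStates A).Nonempty) (hc : IsCompact (tracialStates A))
    (hT : ∀ τ ∈ denselyDefinedLscTraces A,
      ∃ φ ∈ boundedTraces A, ∀ x : PosCone A, τ x = ENNReal.ofReal (φ x.1).re)
    {τ : ExtTrace (Ultrapower ω A)} (hτ : τ ∈ genLimitTraces ω A) {a : A} (ha : 0 ≤ a)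
    (ha0 : a ≠ 0) (hfin : τ ⟨diag ω a, diag_nonneg ω ha⟩ < ∞) :
    ∃ c : ℝ, 0 ≤ c ∧ ∃ σ ∈ limitTraces ω A, ∀ x : PosCone (Ultrapower ω A),
      τ x = ENNReal.ofReal (c * (σ x.1).re) := by
  obtain ⟨τs, hlsc, hform⟩ := hτ
  have hε : 0 < ‖a‖ / 2 := by have := norm_pos_iff.2 ha0; positivity
  set b := cutDown a (‖a‖ / 2) with hb
  have hb0 : b.1 ≠ 0 := by
    intro h
    have h1 := norm_sub_cutDown_le ha hε.le
    rw [← hb, h, sub_zero] at h1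
    linarith
  obtain ⟨m, hm, hmτ⟩ := exists_forall_le_trace hsimple hne hc b.2 hb0
  set L := limUnder (ω : Filter ℕ) (fun n => τs n b) with hL
  have hLτ : L ≤ τ ⟨diag ω a, diag_nonneg ω ha⟩ := by
    have h1 := hform (constSeq a) (fun _ => ha)
    change τ ⟨diag ω a, _⟩ = _ at h1
    rw [h1]
    exact le_iSup₂ (f := fun (ε : ℝ) (_ : 0 < ε) =>
      limUnder (ω : Filter ℕ) fun n => τs n (cutDown (constSeq a n) ε)) (‖a‖ / 2) hε
  have hLfin : L < ∞ := hLτ.trans_lt hfin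
  have hLlim : Tendsto (fun n => τs n b) ω (𝓝 L) := by
    obtain ⟨z, -, hz⟩ := isCompact_univ.ultrafilter_le_nhds (ω.map fun n => τs n b) (by simp)
    exact tendsto_nhds_limUnder ⟨z, hz⟩
  have hlt : ∀ᶠ n in (ω : Filter ℕ), τs n b < L + 1 :=
    hLlim.eventually (gt_mem_nhds (ENNReal.lt_add_right hLfin.ne one_ne_zero))
  have hch : ∀ n, ∃ c : ℝ, 0 ≤ c ∧ ∃ σ ∈ tracialStates A, τs n b < ∞ →
      ∀ x : PosCone A, τs n x = ENNReal.ofReal (c * (σ x.1).re) := by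
    intro n
    by_cases hn : τs n b < ∞
    · have hdd : (τs n).IsDenselyDefined :=
        ExtTrace.IsFinite.isDenselyDefined hsimple (b := b.1) ⟨b.2, hn⟩ hb0
      obtain ⟨φ, hφ, h1⟩ := hT (τs n) ⟨hdd, hlsc n⟩
      obtain ⟨c, hc0, σ, hσ, h2⟩ := boundedTraces.exists_smul_tracialState hne hφ
      exact ⟨c, hc0, σ, hσ, fun _ x => by rw [h1, h2]⟩
    · obtain ⟨σ, hσ⟩ := hne
      exact ⟨0, le_rfl, σ, hσ, fun h => absurd h hn⟩
  choose c hc0 σs hσs hcσ using hch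
  -- `K` bounds `c n` along `ω`; truncating at `K` gives a sequence which converges along `ω`
  let K : ℝ := (L + 1).toReal / m
  have hL1 : L + 1 ≠ ∞ := ENNReal.add_ne_top.2 ⟨hLfin.ne, ENNReal.one_ne_top⟩
  have hK0 : 0 ≤ K := div_nonneg ENNReal.toReal_nonneg hm.le
  let c' : ℕ → ℝ := fun n => min (c n) K
  have hc'0 : ∀ n, 0 ≤ c' n := fun n => le_min (hc0 n) hK0
  obtain ⟨c₀, hc₀, hc₀lim⟩ := (isCompact_Icc (a := (0 : ℝ)) (b := K)).ultrafilter_le_nhds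
    (ω.map c') (by
      rw [Ultrafilter.coe_map, le_principal_iff]
      exact Filter.mem_map.2 (Filter.univ_mem' fun n => ⟨hc'0 n, min_le_right _ _⟩))
  obtain ⟨σ, hσ, hσlim⟩ := exists_limitTrace (ω := ω) hc hσs
  refine ⟨c₀, hc₀.1, σ, hσ, fun x => ?_⟩
  obtain ⟨y, hy0, hyx⟩ := exists_nonneg_seq x.2
  have hx : x = ⟨ofSeq ω y, ofSeq_nonneg ω y hy0⟩ := Subtype.ext hyx.symm
  rw [hx, hform y hy0]
  refine iSup_limUnder_cutDown hσs hσlim hc'0 hc₀lim ?_ y hy0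
  filter_upwards [hlt] with n hn z
  have hnfin : τs n b < ∞ := hn.trans (lt_top_iff_ne_top.2 hL1)
  have hcK : c n ≤ K := by
    rw [le_div_iff₀ hm]
    have h1 := hn.le
    rw [hcσ n hnfin b, ENNReal.ofReal_le_iff_le_toReal hL1] at h1
    exact (mul_le_mul_of_nonneg_left (hmτ _ (hσs n)) (hc0 n)).trans h1
  simp only [c', min_eq_left hcK]
  exact hcσ n hnfin z

end FiniteGeneralisedLimitTraces

/-! ### Correcting elements modulo a closed ideal -/

section Correction

lemma norm_commutator_conj_le {R : Type*} [NonUnitalNormedRing R] {f x : R} (s : R)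
    (hf : ‖f‖ ≤ 1) (hx : ‖x‖ ≤ 1) :
    ‖s * (f * x * f) - f * x * f * s‖ ≤ 2 * ‖f * s - s * f‖ + ‖f * (s * x - x * s)‖ := by
  have h : s * (f * x * f) - f * x * f * s =
      -((f * s - s * f) * x * f) + f * (s * x - x * s) * f - f * x * (f * s - s * f) := by
    noncomm_ring
  have h1 : ‖(f * s - s * f) * x * f‖ ≤ ‖f * s - s * f‖ := by
    calc _ ≤ ‖f * s - s * f‖ * ‖x‖ * ‖f‖ := norm_mul₃_le
      _ ≤ ‖f * s - s * f‖ * 1 * 1 := by gcongr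
      _ = _ := by ring
  have h2 : ‖f * (s * x - x * s) * f‖ ≤ ‖f * (s * x - x * s)‖ :=
    (norm_mul_le _ _).trans (mul_le_of_le_one_right (norm_nonneg _) hf)
  have h3 : ‖f * x * (f * s - s * f)‖ ≤ ‖f * s - s * f‖ := by
    calc _ ≤ ‖f‖ * ‖x‖ * ‖f * s - s * f‖ := norm_mul₃_le
      _ ≤ 1 * 1 * ‖f * s - s * f‖ := by gcongr
      _ = _ := by ring
  rw [h]
  refine (norm_sub_le _ _).trans ?_
  have h4 := norm_add_le (-((f * s - s * f) * x * f)) (f * (s * x - x * s) * f)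
  rw [norm_neg] at h4
  linarith

lemma norm_conj_mul_conj_le {R : Type*} [NonUnitalNormedRing R] {f x x' : R}
    (hf : ‖f‖ ≤ 1) (hx : ‖x‖ ≤ 1) :
    ‖f * x * f * (f * x' * f)‖ ≤ ‖f * (x * x')‖ + 2 * ‖f * x' - x' * f‖ := by
  have h : f * x * f * (f * x' * f) = f * (x * x') * f * f * f +
      (f * x * f * (f * x' - x' * f) * f + f * x * (f * x' - x' * f) * f * f) := by
    noncomm_ring
  have hle : ∀ {u : R}, ‖u * f‖ ≤ ‖u‖ := fun {u} =>
    (norm_mul_le _ _).trans (mul_le_of_le_one_right (norm_nonneg _) hf)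
  have hfx : ‖f * x‖ ≤ 1 := (norm_mul_le _ _).trans (mul_le_one₀ hf (norm_nonneg _) hx)
  have h1 : ‖f * (x * x') * f * f * f‖ ≤ ‖f * (x * x')‖ := hle.trans (hle.trans hle)
  have h2 : ‖f * x * f * (f * x' - x' * f) * f‖ ≤ ‖f * x' - x' * f‖ :=
    hle.trans ((norm_mul_le _ _).trans
      (mul_le_of_le_one_left (norm_nonneg _) (hle.trans hfx)))
  have h3 : ‖f * x * (f * x' - x' * f) * f * f‖ ≤ ‖f * x' - x' * f‖ :=
    hle.trans (hle.trans ((norm_mul_le _ _).trans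
      (mul_le_of_le_one_left (norm_nonneg _) hfx)))
  rw [h]
  refine (norm_add_le _ _).trans ?_
  have h4 := norm_add_le (f * x * f * (f * x' - x' * f) * f)
    (f * x * (f * x' - x' * f) * f * f)
  linarith

/-- Positive contractions which modulo a closed ideal commute with a finite set and are pairwise
orthogonal can be changed by elements of the ideal so that these relations hold approximately:
replace `x` by `(1 - e) x (1 - e)`, with `e` far out in a quasicentral approximate unit. -/
lemma ClosedIdeal.exists_corrected {B : Type*} [NonUnitalCStarAlgebra B] [PartialOrder B]
    [StarOrderedRing B] (J : ClosedIdeal B) {ι : Type*} [Finite ι] {c : ι → B}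
    (hc : ∀ i, ‖c i‖ ≤ 1) (S : Finset B)
    (hS : ∀ s ∈ S, ∀ i, s * (star (c i) * c i) - star (c i) * c i * s ∈ J.toSubmodule)
    (hort : ∀ i j, i ≠ j → star (c i) * c i * (star (c j) * c j) ∈ J.toSubmodule)
    {ε : ℝ} (hε : 0 < ε) :
    ∃ y : ι → B, (∀ i, 0 ≤ y i ∧ ‖y i‖ ≤ 1) ∧
      (∀ i, y i - star (c i) * c i ∈ J.toSubmodule) ∧
      (∀ s ∈ S, ∀ i, ‖s * y i - y i * s‖ < ε) ∧ ∀ i j, i ≠ j → ‖y i * y j‖ < ε := by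
  classical
  have := Fintype.ofFinite ι
  let x : ι → B := fun i => star (c i) * c i
  have hx1 : ∀ i, ‖x i‖ ≤ 1 := fun i => by
    simp only [x, CStarRing.norm_star_mul_self]
    exact mul_le_one₀ (hc i) (norm_nonneg _) (hc i)
  let Z : Finset B := (S ×ˢ Finset.univ).image (fun q : B × ι => q.1 * x q.2 - x q.2 * q.1) ∪
    ((Finset.univ ×ˢ Finset.univ).filter (fun q : ι × ι => q.1 ≠ q.2)).image
      (fun q => x q.1 * x q.2)
  obtain ⟨e, he, heS, heZ⟩ := J.exists_quasicentral (S ∪ Finset.univ.image x) Z (by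
    intro z hz
    simp only [Z, Finset.mem_union, Finset.mem_image, Finset.mem_product, Finset.mem_univ,
      and_true, Finset.mem_filter, true_and, Prod.exists] at hz
    rcases hz with ⟨s, i, hs, rfl⟩ | ⟨i, j, hij, rfl⟩
    exacts [hS s hs i, hort i j hij])
  have hev : ∀ᶠ m in atTop, (∀ s ∈ S ∪ Finset.univ.image x, ‖e m * s - s * e m‖ < ε / 4) ∧
      ∀ z ∈ Z, ‖z - e m * z‖ < ε / 4 := by
    rw [eventually_and, Finset.eventually_all, Finset.eventually_all]
    refine ⟨fun s hs => ?_, fun z hz => ?_⟩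
    · have := (tendsto_zero_iff_norm_tendsto_zero.1 (heS s hs))
      exact this.eventually (gt_mem_nhds (by linarith))
    · have := (tendsto_zero_iff_norm_tendsto_zero.1 (heZ z hz))
      exact this.eventually (gt_mem_nhds (by linarith))
  obtain ⟨m, hmS, hmZ⟩ := hev.exists
  obtain ⟨heJ, he0, he1⟩ := he m
  have hes : star (e m) = e m := (IsSelfAdjoint.of_nonneg he0).star_eq
  -- in the unitization, the corrected elements are the conjugates of the `x i` by `f`
  let f : Unitization ℂ B := 1 - (e m : Unitization ℂ B)
  have he0' : (0 : Unitization ℂ B) ≤ (e m : Unitization ℂ B) := Unitization.inr_nonneg_iff.2 he0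
  have he1' : (e m : Unitization ℂ B) ≤ 1 :=
    (CStarAlgebra.norm_le_one_iff_of_nonneg _ he0').1 (by rwa [Unitization.norm_inr])
  have hf1 : ‖f‖ ≤ 1 :=
    (CStarAlgebra.norm_le_one_iff_of_nonneg _ (sub_nonneg.2 he1')).2 (sub_le_self _ he0')
  let g : ι → B := fun i => c i - c i * e m
  have hg : ∀ i, (g i : Unitization ℂ B) = (c i : Unitization ℂ B) * f := fun i => by
    simp only [g, f, Unitization.inr_sub, Unitization.inr_mul]
    noncomm_ring
  have hy : ∀ i, ((star (g i) * g i : B) : Unitization ℂ B) = f * (x i : Unitization ℂ B) * f := by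
    intro i
    have hfs : star f = f := by
      simp only [f, star_sub, star_one, ← Unitization.inr_star, hes]
    rw [Unitization.inr_mul, Unitization.inr_star, hg, star_mul, hfs]
    simp only [x, Unitization.inr_mul, Unitization.inr_star]
    simp only [mul_assoc]
  have hcomm : ∀ s : B, ‖f * (s : Unitization ℂ B) - s * f‖ = ‖e m * s - s * e m‖ := fun s => by
    rw [← norm_neg, ← Unitization.norm_inr (𝕜 := ℂ) (e m * s - s * e m)]
    congr 1
    simp only [f, Unitization.inr_sub, Unitization.inr_mul]
    noncomm_ring
  have hleft : ∀ z : B, ‖f * (z : Unitization ℂ B)‖ = ‖z - e m * z‖ := fun z => by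
    rw [← Unitization.norm_inr (𝕜 := ℂ) (z - e m * z)]
    congr 1
    simp only [f, Unitization.inr_sub, Unitization.inr_mul]
    noncomm_ring
  refine ⟨fun i => star (g i) * g i, fun i => ⟨star_mul_self_nonneg _, ?_⟩, fun i => ?_,
    fun s hs i => ?_, fun i j hij => ?_⟩
  · have h1 : ‖g i‖ ≤ 1 := by
      rw [← Unitization.norm_inr (𝕜 := ℂ), hg]
      refine (norm_mul_le _ _).trans (mul_le_one₀ ?_ (norm_nonneg _) hf1)
      rw [Unitization.norm_inr]; exact hc i
    rw [CStarRing.norm_star_mul_self]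
    exact mul_le_one₀ h1 (norm_nonneg _) h1
  · have h1 : star (g i) * g i - star (c i) * c i =
        -(e m * (star (c i) * c i)) - star (c i) * c i * e m +
          e m * (star (c i) * c i * e m) := by
      simp only [g, star_sub, star_mul, hes]
      noncomm_ring
    rw [h1]
    exact add_mem (sub_mem (neg_mem (J.mul_right_mem' _ heJ)) (J.mul_left_mem' _ heJ))
      (J.mul_right_mem' _ heJ)
  · have h1 := norm_commutator_conj_le (s : Unitization ℂ B) hf1
      (x := (x i : Unitization ℂ B)) (by rw [Unitization.norm_inr]; exact hx1 i)
    rw [hcomm, ← hy, ← Unitization.inr_mul, ← Unitization.inr_mul, ← Unitization.inr_sub,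
      ← Unitization.inr_mul, ← Unitization.inr_mul, ← Unitization.inr_sub, hleft,
      Unitization.norm_inr] at h1
    have h2 := hmS s (Finset.mem_union_left _ hs)
    have h3 := hmZ (s * x i - x i * s) (by
      refine Finset.mem_union_left _ (Finset.mem_image.2 ⟨(s, i), ?_, rfl⟩)
      simp [hs])
    linarith
  · have h1 := norm_conj_mul_conj_le hf1 (x := (x i : Unitization ℂ B))
      (x' := (x j : Unitization ℂ B)) (by rw [Unitization.norm_inr]; exact hx1 i)
    rw [hcomm, ← hy, ← hy, ← Unitization.inr_mul, ← Unitization.inr_mul, hleft,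
      Unitization.norm_inr] at h1
    have h2 := hmS (x j) (Finset.mem_union_right _ (Finset.mem_image_of_mem _ (Finset.mem_univ j)))
    have h3 := hmZ (x i * x j) (by
      refine Finset.mem_union_right _ (Finset.mem_image.2 ⟨(i, j), ?_, rfl⟩)
      simp [hij])
    linarith

/-- Projections which add up to a unit are pairwise orthogonal. -/
lemma mul_eq_zero_of_sum_eq_unit {Q : Type*} [NonUnitalCStarAlgebra Q] {ι : Type*} [Fintype ι]
    {p : ι → Q} (hp : ∀ i, IsStarProjection (p i)) (hsum : ∀ y, (∑ i, p i) * y = y) {i j : ι}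
    (hij : i ≠ j) : p i * p j = 0 := by
  classical
  let _ := CStarAlgebra.spectralOrder Q
  have := CStarAlgebra.spectralOrderedRing Q
  have hps : ∀ k, star (p k) = p k := fun k => (hp k).isSelfAdjoint
  have hpp : ∀ k, p k * p k = p k := fun k => (hp k).isIdempotentElem
  -- `∑ₖ pⱼ pₖ pⱼ = pⱼ`, where the term `k = j` is `pⱼ` and all terms are positive
  have hterm : ∀ k, p j * (p k * p j) = star (p k * p j) * (p k * p j) := fun k => by
    rw [star_mul, hps, hps, mul_assoc, ← mul_assoc (p k) (p k), hpp]
  have h1 : ∑ k, p j * (p k * p j) = p j := by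
    rw [← Finset.mul_sum, ← Finset.sum_mul, hsum, hpp]
  rw [← Finset.add_sum_erase _ _ (Finset.mem_univ j), hpp, hpp, add_eq_left] at h1
  have h2 := (Finset.sum_eq_zero_iff_of_nonneg (fun k _ => by
    rw [hterm]; exact star_mul_self_nonneg _)).1 h1 i (by simp [hij])
  rw [hterm] at h2
  exact (CStarRing.star_mul_self_eq_zero_iff _).1 h2

end Correction

/-! ### From uniform to stabilised property Γ -/

section UniformToStabilised

open scoped ComplexOrder

variable {ω : Ultrafilter ℕ} {A : Type*} [NonUnitalCStarAlgebra A] [PartialOrder A]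
  [StarOrderedRing A]

lemma tendsto_zero_of_forall_eventually_lt {g : ℕ → ℝ} (h0 : ∀ k, 0 ≤ g k)
    (h : ∀ᶠ N : ℕ in atTop, ∀ᶠ k in (ω : Filter ℕ), g k < 1 / (N + 1)) :
    Tendsto g ω (𝓝 0) := by
  refine tendsto_order.2 ⟨fun c hc => Eventually.of_forall fun k => hc.trans_le (h0 k),
    fun c hc => ?_⟩
  have h1 : ∀ᶠ N : ℕ in atTop, 1 / ((N : ℝ) + 1) < c :=
    tendsto_one_div_add_atTop_nhds_zero_nat.eventually (gt_mem_nhds hc)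
  obtain ⟨N, hN, hN'⟩ := (h.and h1).exists
  filter_upwards [hN] with k hk using hk.trans hN'

/-- If `A` is separable, then finitely many pairwise orthogonal positive contractions of
`A^ω ∩ A'`, given by lifts `c i* c i`, lift to pairwise orthogonal positive contractions of
`A_ω ∩ A'`. -/
lemma exists_central_orthogonal_lift [TopologicalSpace.SeparableSpace A]
    (hω : (ω : Filter ℕ) ≤ Filter.cofinite) (hne : (tracialStates A).Nonempty)
    (hc : IsCompact (tracialStates A)) {ι : Type*} [Finite ι] {c : ι → Ultrapower ω A}
    (hc1 : ∀ i, ‖c i‖ ≤ 1)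
    (hcomm : ∀ (a : A) i, diag ω a * (star (c i) * c i) - star (c i) * c i * diag ω a ∈
      (traceKernel ω A).toSubmodule)
    (hort : ∀ i j, i ≠ j → star (c i) * c i * (star (c j) * c j) ∈
      (traceKernel ω A).toSubmodule) :
    ∃ y : ι → Ultrapower ω A, (∀ i, 0 ≤ y i ∧ ‖y i‖ ≤ 1) ∧ (∀ i, y i ∈ relComm ω A) ∧
      (∀ i j, i ≠ j → y i * y j = 0) ∧
      ∀ i, y i - star (c i) * c i ∈ (traceKernel ω A).toSubmodule := by
  classical
  let J := traceKernel ω A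
  let d : ℕ → A := TopologicalSpace.denseSeq A
  choose X hX using fun i => ofSeq_surjective (star (c i) * c i)
  let T : Type _ := {y : ι → A // ∀ i, 0 ≤ y i ∧ ‖y i‖ ≤ 1}
  have : Nonempty T := ⟨⟨0, fun i => by simp⟩⟩
  -- the conditions on the `k`-th terms, up to the tolerance `1 / (N + 1)`
  let P : ℕ → ℕ → T → Prop := fun N k y =>
    (∀ i, ∀ j ≤ N, ‖d j * y.1 i - y.1 i * d j‖ < 1 / (N + 1)) ∧
    (∀ i j, i ≠ j → ‖y.1 i * y.1 j‖ < 1 / (N + 1)) ∧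
    ∀ i, ∀ τ ∈ tracialStates A, (τ (star (y.1 i - X i k) * (y.1 i - X i k))).re < 1 / (N + 1)
  have hPanti : ∀ ⦃N M : ℕ⦄, N ≤ M → ∀ k y, P M k y → P N k y := by
    intro N M hNM k y hy
    have h1 : 1 / ((M : ℝ) + 1) ≤ 1 / (N + 1) := Nat.one_div_le_one_div hNM
    exact ⟨fun i j hj => (hy.1 i j (hj.trans hNM)).trans_le h1,
      fun i j hij => (hy.2.1 i j hij).trans_le h1,
      fun i τ hτ => (hy.2.2 i τ hτ).trans_le h1⟩
  have hPex : ∀ N, ∀ᶠ k in (ω : Filter ℕ), ∃ y, P N k y := by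
    intro N
    have hN : (0 : ℝ) < 1 / (N + 1) := by positivity
    obtain ⟨Y, hY01, hYJ, hYS, hYo⟩ := J.exists_corrected hc1
      ((Finset.range (N + 1)).image fun j => diag ω (d j))
      (by
        intro s hs i
        obtain ⟨j, -, rfl⟩ := Finset.mem_image.1 hs
        exact hcomm (d j) i) hort hN
    choose b hb01 hbY using fun i => exists_nonneg_contraction_seq (hY01 i).1 (hY01 i).2
    have h1 : ∀ᶠ k in (ω : Filter ℕ), ∀ i, ∀ j ∈ Finset.range (N + 1),
        ‖d j * b i k - b i k * d j‖ < 1 / (N + 1) := by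
      refine eventually_all.2 fun i => (Finset.eventually_all _).2 fun j hj => ?_
      have h := hYS _ (Finset.mem_image_of_mem (fun j => diag ω (d j)) hj) i
      rw [← hbY] at h
      exact eventually_norm_lt (a := constSeq (d j) * b i - b i * constSeq (d j)) (by
        rwa [ofSeq_sub, ofSeq_mul, ofSeq_mul])
    have h2 : ∀ᶠ k in (ω : Filter ℕ), ∀ i j, i ≠ j → ‖b i k * b j k‖ < 1 / (N + 1) := by
      refine eventually_all.2 fun i => eventually_all.2 fun j => ?_
      by_cases hij : i = j
      · exact Eventually.of_forall fun k h => absurd hij h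
      · have h := hYo i j hij
        rw [← hbY, ← hbY] at h
        filter_upwards [eventually_norm_lt (a := b i * b j) h] with k hk _ using hk
    have h3 : ∀ᶠ k in (ω : Filter ℕ), ∀ i, ∀ τ ∈ tracialStates A,
        (τ (star (b i k - X i k) * (b i k - X i k))).re < 1 / (N + 1) := by
      refine eventually_all.2 fun i => ?_
      refine (ofSeq_mem_traceKernel_iff hne hc (b i - X i)).1 ?_ _ hN
      rw [ofSeq_sub, hbY, hX]
      exact hYJ i
    filter_upwards [h1, h2, h3] with k hk1 hk2 hk3
    exact ⟨⟨fun i => b i k, fun i => hb01 i k⟩,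
      fun i j hj => hk1 i j (Finset.mem_range.2 (Nat.lt_succ_of_le hj)), hk2, hk3⟩
  obtain ⟨y, hy⟩ := exists_seq_of_forall_eventually hω P hPanti hPex
  let E : ι → BddSeq A := fun i => mkSeq (fun k => (y k).1 i) 1 fun k => ((y k).2 i).2
  refine ⟨fun i => ofSeq ω (E i), fun i => ⟨ofSeq_nonneg ω _ fun k => ((y k).2 i).1, ?_⟩,
    fun i => ?_, fun i j hij => ?_, fun i => ?_⟩
  · exact (norm_ofSeq_le _).trans
      (lp.norm_le_of_forall_le zero_le_one fun k => ((y k).2 i).2)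
  · rw [mem_relComm]
    have hcl : IsClosed {a : A | diag ω a * ofSeq ω (E i) = ofSeq ω (E i) * diag ω a} := by
      have := continuous_diag (ω := ω) (A := A)
      exact isClosed_eq (by fun_prop) (by fun_prop)
    have hd : Set.range d ⊆ {a : A | diag ω a * ofSeq ω (E i) = ofSeq ω (E i) * diag ω a} := by
      rintro _ ⟨j, rfl⟩
      change diag ω (d j) * ofSeq ω (E i) = ofSeq ω (E i) * diag ω (d j)
      rw [← sub_eq_zero, diag, ← ofSeq_mul, ← ofSeq_mul, ← ofSeq_sub, ofSeq_eq_zero_iff]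
      refine tendsto_zero_of_forall_eventually_lt (fun k => norm_nonneg _) ?_
      filter_upwards [eventually_ge_atTop j] with N hN
      filter_upwards [hy N] with k hk using hk.1 i j hN
    have hall := hcl.closure_subset_iff.2 hd
    rw [(TopologicalSpace.denseRange_denseSeq A).closure_range] at hall
    exact fun a => hall (Set.mem_univ a)
  · rw [← ofSeq_mul, ofSeq_eq_zero_iff]
    refine tendsto_zero_of_forall_eventually_lt (fun k => norm_nonneg _)
      (Eventually.of_forall fun N => ?_)
    filter_upwards [hy N] with k hk using hk.2.1 i j hij
  · rw [← hX, ← ofSeq_sub, ofSeq_mem_traceKernel_iff hne hc]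
    intro ε hε
    obtain ⟨N, hN⟩ := exists_nat_one_div_lt hε
    filter_upwards [hy N] with k hk τ hτ
    exact (hk.2.2 i τ hτ).trans hN

omit [PartialOrder A] [StarOrderedRing A] in
/-- An element of `A_ω ∩ A'` which is positive in `A_ω` is positive in `F_ω(A)`: its square root
also commutes with `A`. -/
lemma annIdeal_proj_nonneg {y : Ultrapower ω A} (hy : 0 ≤ y) (hyc : y ∈ relComm ω A) :
    0 ≤ (annIdeal ω A).proj ⟨y, hyc⟩ := by
  have hs : star (CFC.sqrt y) = CFC.sqrt y :=
    (IsSelfAdjoint.of_nonneg (CFC.sqrt_nonneg y)).star_eq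
  have hmem : CFC.sqrt y ∈ relComm ω A := by
    rw [CFC.sqrt_eq_real_sqrt y hy]
    exact cfcₙ_mem (s := relComm ω A) (𝕜' := ℂ) _ hyc
  let r : relComm ω A := ⟨CFC.sqrt y, hmem⟩
  have hr : (⟨y, hyc⟩ : relComm ω A) = star r * r := by
    refine Subtype.ext ?_
    change y = star (CFC.sqrt y) * CFC.sqrt y
    rw [hs, CFC.sqrt_mul_sqrt_self y hy]
  rw [hr, ClosedIdeal.proj_mul, ClosedIdeal.proj_star]
  exact star_mul_self_nonneg _

/-- Uniform property Γ implies stabilised property Γ if `A` is simple and separable, `T(A)` is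
compact and non-empty, and the densely defined lower semicontinuous traces on `A` are bounded. -/
theorem HasUniformGamma.hasStabilisedGamma [TopologicalSpace.SeparableSpace A]
    (hω : (ω : Filter ℕ) ≤ Filter.cofinite) (hsimple : IsSimpleCStar A)
    (hne : (tracialStates A).Nonempty) (hc : IsCompact (tracialStates A))
    (hT : ∀ τ ∈ denselyDefinedLscTraces A,
      ∃ φ ∈ boundedTraces A, ∀ x : PosCone A, τ x = ENNReal.ofReal (φ x.1).re)
    (h : HasUniformGamma ω A) : HasStabilisedGamma ω A := by
  intro n hn
  obtain ⟨p, hp, hpc, hpsum, hpτ⟩ := h n hn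
  let J := traceKernel ω A
  have hn' : (0 : ℝ) < n := by exact_mod_cast hn
  have hpn : ∀ i, ‖p i‖ ≤ 1 := fun i => by
    have h1 : ‖p i‖ * ‖p i‖ = ‖p i‖ := by
      rw [← CStarRing.norm_star_mul_self, (hp i).isSelfAdjoint.star_eq,
        (hp i).isIdempotentElem.eq]
    nlinarith [norm_nonneg (p i)]
  choose c hcs hc1 hcp using fun i => J.exists_selfAdjoint_lift (hp i).isSelfAdjoint (hpn i)
  have hxp : ∀ i, J.proj (star (c i) * c i) = p i := fun i => by
    rw [(hcs i).star_eq, ClosedIdeal.proj_mul, hcp, (hp i).isIdempotentElem.eq]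
  obtain ⟨y, hy01, hyc, hyo, hyJ⟩ := exists_central_orthogonal_lift hω hne hc hc1
    (fun a i => by
      rw [← ClosedIdeal.proj_eq_proj, ClosedIdeal.proj_mul _ (diag ω a),
        ClosedIdeal.proj_mul _ (star (c i) * c i), hxp]
      exact hpc i a)
    (fun i j hij => by
      rw [← ClosedIdeal.proj_eq_zero, ClosedIdeal.proj_mul _ (star (c i) * c i), hxp, hxp]
      exact mul_eq_zero_of_sum_eq_unit hp (fun y => (hpsum y).1) hij)
  have hyp : ∀ i, J.proj (y i) = p i := fun i => by
    rw [← hxp, ClosedIdeal.proj_eq_proj]; exact hyJ i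
  refine ⟨fun i => ⟨(annIdeal ω A).proj ⟨y i, hyc i⟩, annIdeal_proj_nonneg (hy01 i).1 (hyc i)⟩,
    fun i => ?_, fun i j hij => ?_, fun a τ hτ hfin i => ?_⟩
  · exact ((annIdeal ω A).norm_proj_le _).trans (hy01 i).2
  · rw [← ClosedIdeal.proj_mul, ClosedIdeal.proj_eq_zero]
    have h0 : (⟨y i, hyc i⟩ * ⟨y j, hyc j⟩ : relComm ω A) = 0 := Subtype.ext (hyo i j hij)
    rw [h0]
    exact zero_mem _
  · by_cases ha0 : a.1 = 0
    · have hd : diag ω a.1 = 0 := by rw [ha0]; exact map_zero (nullIdeal ω A).proj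
      have h1 : inducedTrace ω τ a ⟨(annIdeal ω A).proj ⟨y i, hyc i⟩,
          annIdeal_proj_nonneg (hy01 i).1 (hyc i)⟩ = τ ⟨0, le_rfl⟩ := by
        rw [inducedTrace]
        congr 2
        rw [leftMul_proj, hd, zero_mul]
      have h2 : τ ⟨diag ω a.1, diag_nonneg ω a.2⟩ = τ ⟨0, le_rfl⟩ := by
        congr 2
      rw [h1, h2, τ.map_zero', mul_zero]
    · obtain ⟨l, hl, σ, hσ, hτσ⟩ :=
        genLimitTraces.exists_eq_smul_limitTrace hsimple hne hc hT hτ a.2 ha0 hfin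
      obtain ⟨σ', hσ', hσσ'⟩ := exists_tracialLimitTrace hσ
      have h1 : σ (diag ω a.1 * y i) = (1 / n : ℂ) * σ (diag ω a.1) := by
        rw [← hσσ', ← hσσ', ClosedIdeal.proj_mul]
        change σ' (tracialDiag ω a.1 * J.proj (y i)) = _ * σ' (tracialDiag ω a.1)
        rw [hyp]
        exact hpτ a.1 σ' hσ' i
      have h2 : (σ (diag ω a.1 * y i)).re = (1 / n : ℝ) * (σ (diag ω a.1)).re := by
        rw [h1, ← Complex.re_ofReal_mul]
        push_cast
        rfl
      have h3 : (1 / n : ℝ≥0∞) = ENNReal.ofReal (1 / n) := by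
        rw [ENNReal.ofReal_div_of_pos hn', ENNReal.ofReal_one, ENNReal.ofReal_natCast]
      rw [inducedTrace, hτσ, hτσ, h3, ← ENNReal.ofReal_mul (by positivity)]
      congr 1
      simp only [leftMul_proj]
      rw [h2]
      ring

end UniformToStabilised

end CStarGamma

end

theorem mainTheorem4 (ω : Ultrafilter ℕ) (hω : (ω : Filter ℕ) ≤ Filter.cofinite)
    (A : Type*) [NonUnitalCStarAlgebra A] [PartialOrder A] [StarOrderedRing A]
    [TopologicalSpace.SeparableSpace A] (hsimple : CStarGamma.IsSimpleCStar A)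
    (hne : (CStarGamma.tracialStates A).Nonempty)
    (hcompact : IsCompact (CStarGamma.tracialStates A)) :
    (CStarGamma.HasStabilisedGamma ω A → CStarGamma.HasUniformGamma ω A) ∧
    ((CStarGamma.IsUnital A ∨
        CStarGamma.denselyDefinedLscTraces A = CStarGamma.boundedExtTraces A) →
      CStarGamma.HasUniformGamma ω A → CStarGamma.HasStabilisedGamma ω A) := by
  refine ⟨fun h => h.hasUniformGamma hcompact, fun hT h =>
    h.hasStabilisedGamma hω hsimple hne hcompact fun τ hτ => ?_⟩
  rcases hT with hu | heq
  · exact CStarGamma.ExtTrace.exists_boundedTrace_of_forall_finite (hu.forall_finite hτ.1)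
  · rw [heq] at hτ
    exact hτ
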